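/- Let $D\subseteq\mathbb R^2$ be open, let $2\le m\le\infty$ (or $m=\omega$), and let $q,r:D\to\mathbb C$ be a $C^m$ solution of the coupled DNLS (Kaup–Newell) system $$iq_t+q_{xx}-i(q^2r)_x=0,\qquad ir_t-r_{xx}-i(r^2q)_x=0 .$$ Put $J=\mathrm{diag}(i,-i)$, $\sigma=\begin{pmatrix}0&1\\1&0\end{pmatrix}$, $R=\begin{pmatrix}0&q\\r&0\end{pmatrix}$, $U=\begin{pmatrix}0&-iq_x-rq^2\\ir_x-r^2q&0\end{pmatrix}$. Let $n\ge1$, $\lambda_1,\dots,\lambda_n\in\mathbb C\setminus\{0\}$, $\Lambda_i=\mathrm{diag}(\lambda_i,-\lambda_i)$, and let $f_1,\dots,f_n$ be $C^m$ functions on $D$ such that $f=f_i$, $\lambda=\lambda_i$ satisfy the Riccati equations $$f_x+\lambda qf^2-2i\lambda^2f-\lambda r=0,$$ $$f_t+\lambda(iq_x+rq^2+2\lambda^2q)f^2-2i\lambda^2(2\lambda^2+qr)f-\lambda(qr^2+2\lambda^2r-ir_x)=0 .$$ For an invertible block $A$ write $\begin{vmatrix}\rho&\boxed{d}\\A&c\end{vmatrix}=d-\rho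 A^{-1}c$ (quasideterminant). For $1\le k\le n$ let $\mathcal A_k$ be the $k\times k$ matrix whose $i$-th column is $(f_i\lambda_i,\lambda_i^2,f_i\lambda_i^3,\lambda_i^4,\dots)^T$ and $\mathcal B_k$ the one whose $i$-th column is $(\lambda_i,f_i\lambda_i^2,\lambda_i^3,f_i\lambda_i^4,\dots)^T$. With $\mathfrak 1=(1,\dots,1)$, $\mathfrak f=(f_1,\dots,f_n)$, $\mathfrak e_1=(1,0,\dots,0)^T$, set $$q_{[n+1]}=r+\begin{vmatrix}\mathfrak f&\boxed0\\ \mathcal B_n&\mathfrak e_1\end{vmatrix}_x,\quad r_{[n+1]}=q+\begin{vmatrix}\mathfrak 1&\boxed0\\ \mathcal A_n&\mathfrak e_1\end{vmatrix}_x\qquad(n\text{ odd}),$$ $$q_{[n+1]}=q+\begin{vmatrix}\mathfrak 1&\boxed0\\ \mathcal A_n&\mathfrak e_1\end{vmatrix}_x,\quad r_{[n+1]}=r+\begin{vmatrix}\mathfrak f&\boxed0\\ \mathcal B_n&\mathfrak e_1\end{vmatrix}_x\qquad(n\text{ even}).$$ (1) Let $\theta_i=\begin{pmatrix}\phi_{2i-1}&\phi_{2i}\\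 f_i\phi_{2i-1}&-f_i\phi_{2i}\end{pmatrix}$ $(1\le i\le n)$ be $C^m$ matrix functions on $D$ with $$\theta_{i,x}+J\theta_i\Lambda_i^2-R\theta_i\Lambda_i=0,\qquad \theta_{i,t}+2J\theta_i\Lambda_i^4-2R\theta_i\Lambda_i^3+qrJ\theta_i\Lambda_i^2+U\theta_i\Lambda_i=0 .$$ Define the iterated Darboux transformation by $\theta_i^{[1]}=\theta_i$, $R_{[1]}=R$, $\theta_{[k]}=\theta_k^{[k]}$, $$\theta_i^{[k+1]}=\sigma\bigl(\theta_i^{[k]}-\theta_{[k]}\Lambda_k^{-1}\theta_{[k]}^{-1}\theta_i^{[k]}\Lambda_i\bigr),\qquad \sigma R_{[k+1]}\sigma=R_{[k]}-\bigl(\theta_{[k]}\Lambda_k^{-1}\theta_{[k]}^{-1}\bigr)_x,$$ and suppose $\theta_{[1]},\dots,\theta_{[n]}$ are invertible at every point of $D$. Then $\mathcal A_k,\mathcal B_k$ $(k\le n)$ and the $2n\times2n$ block matrix $(\theta_i\Lambda_i^j)$ (block row $j$, block column $i$, $1\le i,j\le n$) are invertible on $D$, the quasideterminant below is $C^m$ with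 zero diagonal entries, and on $D$ $$\sigma^nR_{[n+1]}\sigma^n=R+\begin{vmatrix}\theta_1&\cdots&\theta_n&\boxed{0_2}\\ \theta_1\Lambda_1&\cdots&\theta_n\Lambda_n&I_2\\ \theta_1\Lambda_1^2&\cdots&\theta_n\Lambda_n^2&0_2\\ \vdots&&\vdots&\vdots\\ \theta_1\Lambda_1^n&\cdots&\theta_n\Lambda_n^n&0_2\end{vmatrix}_x,\qquad R_{[n+1]}=\begin{pmatrix}0&q_{[n+1]}\\ r_{[n+1]}&0\end{pmatrix},$$ and $(q_{[n+1]},r_{[n+1]})$ is again a $C^m$ solution of the coupled DNLS system on $D$. (2) For any Riccati solutions $f_i$ as above for which $\mathcal A_k,\mathcal B_k$ $(1\le k\le n)$ are invertible at every point of $D$, the two scalar quasideterminants are $C^m$ on $D$ and $(q_{[n+1]},r_{[n+1]})$ is a $C^m$ solution of the coupled DNLS system on $D$. If $n=1$, $$q_{[2]}=r-\frac1{\lambda_1}f_{1,x},\qquad r_{[2]}=q-\frac1{\lambda_1}\Bigl(\frac1{f_1}\Bigr)_x .$$ If $n=2$, then $\lambda_2f_1-\lambda_1f_2$ and $\lambda_1f_1-\lambda_2f_2$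 have no zeros on $D$ and $$q_{[3]}=q+\frac{\lambda_1^2-\lambda_2^2}{\lambda_1\lambda_2}\Bigl(\frac1{\lambda_2f_1-\lambda_1f_2}\Bigr)_x,\qquad r_{[3]}=r-\frac{\lambda_1^2-\lambda_2^2}{\lambda_1\lambda_2}\Bigl(\frac{f_1f_2}{\lambda_1f_1-\lambda_2f_2}\Bigr)_x .$$ -/

import Mathlib

open Matrix
open scoped ContDiff

namespace DNLS

noncomputable section

/-- Partial derivative in `x` of a function of `(x, t)`. -/
def dx (g : ℝ × ℝ → ℂ) (p : ℝ × ℝ) : ℂ := deriv (fun s : ℝ => g (s, p.2)) p.1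

/-- Partial derivative in `t` of a function of `(x, t)`. -/
def dt (g : ℝ × ℝ → ℂ) (p : ℝ × ℝ) : ℂ := deriv (fun s : ℝ => g (p.1, s)) p.2

/-- Entrywise `x`-derivative of a `2 × 2` matrix function. -/
def dxMat (A : ℝ × ℝ → Matrix (Fin 2) (Fin 2) ℂ) (p : ℝ × ℝ) : Matrix (Fin 2) (Fin 2) ℂ :=
  Matrix.of fun a b => dx (fun p' => A p' a b) p

/-- Entrywise `t`-derivative of a `2 × 2` matrix function. -/
def dtMat (A : ℝ × ℝ → Matrix (Fin 2) (Fin 2) ℂ) (p : ℝ × ℝ) : Matrix (Fin 2) (Fin 2) ℂ :=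
  Matrix.of fun a b => dt (fun p' => A p' a b) p

/-- `(q, r)` is a solution of class `C^m` on `D` of the coupled DNLS (Kaup–Newell) system
`i q_t + q_xx - i (q² r)_x = 0`, `i r_t - r_xx - i (r² q)_x = 0`. -/
structure IsSolution (m : WithTop ℕ∞) (D : Set (ℝ × ℝ)) (q r : ℝ × ℝ → ℂ) : Prop where
  contDiff_q : ContDiffOn ℝ m q D
  contDiff_r : ContDiffOn ℝ m r D
  eq_q : ∀ p ∈ D,
    Complex.I * dt q p + dx (dx q) p - Complex.I * dx (fun p' => q p' ^ 2 * r p') p = 0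
  eq_r : ∀ p ∈ D,
    Complex.I * dt r p - dx (dx r) p - Complex.I * dx (fun p' => r p' ^ 2 * q p') p = 0

/-- `f` is a `C^m` solution on `D` of the two Riccati equations with potentials `q, r` and
spectral parameter `l`. -/
structure IsRiccatiSolution (m : WithTop ℕ∞) (D : Set (ℝ × ℝ)) (q r : ℝ × ℝ → ℂ) (l : ℂ)
    (f : ℝ × ℝ → ℂ) : Prop where
  contDiff : ContDiffOn ℝ m f D
  eq_x : ∀ p ∈ D,
    dx f p + l * q p * f p ^ 2 - 2 * l ^ 2 * Complex.I * f p - l * r p = 0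
  eq_t : ∀ p ∈ D,
    dt f p + l * (Complex.I * dx q p + r p * q p ^ 2 + 2 * l ^ 2 * q p) * f p ^ 2
      - 2 * Complex.I * l ^ 2 * (2 * l ^ 2 + q p * r p) * f p
      - l * (q p * r p ^ 2 + 2 * l ^ 2 * r p - Complex.I * dx r p) = 0

/-! The matrices of the Lax pair and of the Darboux transformation. -/

def J : Matrix (Fin 2) (Fin 2) ℂ := !![Complex.I, 0; 0, -Complex.I]

def R (q r : ℝ × ℝ → ℂ) (p : ℝ × ℝ) : Matrix (Fin 2) (Fin 2) ℂ := !![0, q p; r p, 0]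

def U (q r : ℝ × ℝ → ℂ) (p : ℝ × ℝ) : Matrix (Fin 2) (Fin 2) ℂ :=
  !![0, -Complex.I * dx q p - r p * q p ^ 2; Complex.I * dx r p - r p ^ 2 * q p, 0]

def sigma : Matrix (Fin 2) (Fin 2) ℂ := !![0, 1; 1, 0]

def Lam (l : ℂ) : Matrix (Fin 2) (Fin 2) ℂ := !![l, 0; 0, -l]

/-- `θ` is a `C^m` matrix eigenfunction of the Lax pair, `L(θ) = M(θ) = 0`, with matrix
eigenvalue `Lam l` (the powers of the spectral parameter act on `θ` from the right). -/
structure IsEigenfunction (m : WithTop ℕ∞) (D : Set (ℝ × ℝ)) (q r : ℝ × ℝ → ℂ) (l : ℂ)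
    (θ : ℝ × ℝ → Matrix (Fin 2) (Fin 2) ℂ) : Prop where
  contDiff : ∀ a b, ContDiffOn ℝ m (fun p => θ p a b) D
  eq_L : ∀ p ∈ D, dxMat θ p + J * θ p * Lam l ^ 2 - R q r p * θ p * Lam l = 0
  eq_M : ∀ p ∈ D,
    dtMat θ p + (2 : ℂ) • (J * θ p * Lam l ^ 4) - (2 : ℂ) • (R q r p * θ p * Lam l ^ 3)
      + (q p * r p) • (J * θ p * Lam l ^ 2) + U q r p * θ p * Lam l = 0

/-- The matrix `θ` with rows `(φ, φ')` and `(f φ, -f φ')`. -/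
def thetaMat (f φ φ' : ℝ × ℝ → ℂ) (p : ℝ × ℝ) : Matrix (Fin 2) (Fin 2) ℂ :=
  !![φ p, φ' p; f p * φ p, -(f p * φ' p)]

/-! Iteration of the reduced Darboux transformation. Indices start at `0`: what is usually
written `θ_i, Λ_i, λ_i` with `i = 1, …, n` is `θ (i-1)` and so on. -/

/-- `thetaIter θ lam k i` is the `k`-th Darboux transform of `θ i`:
`φ_{[k+1]} = σ (φ_{[k]} - θ_{[k]} Λ_k⁻¹ θ_{[k]}⁻¹ λ φ_{[k]})` with `φ`, `λ φ` replaced by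
`θ i`, `θ i * Λ i`; the matrix `θ_{[k+1]}` that drives step `k + 1` is `thetaIter θ lam k k`. -/
def thetaIter (θ : ℕ → ℝ × ℝ → Matrix (Fin 2) (Fin 2) ℂ) (lam : ℕ → ℂ) :
    ℕ → ℕ → ℝ × ℝ → Matrix (Fin 2) (Fin 2) ℂ
  | 0, i, p => θ i p
  | k + 1, i, p =>
      sigma * (thetaIter θ lam k i p
        - thetaIter θ lam k k p * (Lam (lam k))⁻¹ * (thetaIter θ lam k k p)⁻¹
          * (thetaIter θ lam k i p * Lam (lam i)))

/-- `RIter R₀ θ lam k` is `R_{[k+1]}`, given by `R_{[1]} = R₀` and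
`σ R_{[k+1]} σ = R_{[k]} - (θ_{[k]} Λ_k⁻¹ θ_{[k]}⁻¹)_x` (recall `σ² = 1`). -/
def RIter (R₀ : ℝ × ℝ → Matrix (Fin 2) (Fin 2) ℂ)
    (θ : ℕ → ℝ × ℝ → Matrix (Fin 2) (Fin 2) ℂ) (lam : ℕ → ℂ) :
    ℕ → ℝ × ℝ → Matrix (Fin 2) (Fin 2) ℂ
  | 0, p => R₀ p
  | k + 1, p =>
      sigma * (RIter R₀ θ lam k p
        - dxMat (fun p' => thetaIter θ lam k k p' * (Lam (lam k))⁻¹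
            * (thetaIter θ lam k k p')⁻¹) p) * sigma

/-! Quasideterminants. -/

/-- The quasideterminant, expanded about the boxed block `d`, of the block matrix with first
block row `(row, d)` and second block row `(A, col)`, for an invertible square matrix `A`. -/
def quasidet {ι κ μ : Type*} [Fintype ι] [DecidableEq ι] (row : Matrix κ ι ℂ)
    (d : Matrix κ μ ℂ) (A : Matrix ι ι ℂ) (col : Matrix ι μ ℂ) : Matrix κ μ ℂ :=
  d - row * A⁻¹ * col

/-- The same with a scalar boxed entry `d`, a row vector and a column vector. -/
def quasidetScalar {ι : Type*} [Fintype ι] [DecidableEq ι] (row : ι → ℂ) (d : ℂ)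
    (A : Matrix ι ι ℂ) (col : ι → ℂ) : ℂ :=
  d - row ⬝ᵥ (A⁻¹ *ᵥ col)

/-- `Θ = (θ_1, …, θ_n)`. -/
def Theta (θ : ℕ → ℝ × ℝ → Matrix (Fin 2) (Fin 2) ℂ) (n : ℕ) (p : ℝ × ℝ) :
    Matrix (Fin 2) (Fin n × Fin 2) ℂ :=
  Matrix.of fun a ib => θ ib.1 p a ib.2

/-- The `2n × 2n` block matrix with block `θ_i Λ_i^j` in block row `j` and block column `i`,
`i, j = 1, …, n`. -/
def ThetaHat (θ : ℕ → ℝ × ℝ → Matrix (Fin 2) (Fin 2) ℂ) (lam : ℕ → ℂ) (n : ℕ) (p : ℝ × ℝ) :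
    Matrix (Fin n × Fin 2) (Fin n × Fin 2) ℂ :=
  Matrix.of fun ja ib => (θ ib.1 p * Lam (lam ib.1) ^ ((ja.1 : ℕ) + 1)) ja.2 ib.2

/-- The block column `(I₂, 0₂, …, 0₂)ᵀ`. -/
def blockE (n : ℕ) : Matrix (Fin n × Fin 2) (Fin 2) ℂ :=
  Matrix.of fun ja b => if (ja.1 : ℕ) = 0 ∧ ja.2 = b then 1 else 0

/-- The quasideterminant with block rows `(θ_1, …, θ_n, [0₂])`, `(θ_1Λ_1, …, θ_nΛ_n, I₂)`,
`(θ_1Λ_1^j, …, θ_nΛ_n^j, 0₂)` for `2 ≤ j ≤ n`. -/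
def blockQuasidet (θ : ℕ → ℝ × ℝ → Matrix (Fin 2) (Fin 2) ℂ) (lam : ℕ → ℂ) (n : ℕ)
    (p : ℝ × ℝ) : Matrix (Fin 2) (Fin 2) ℂ :=
  quasidet (Theta θ n p) 0 (ThetaHat θ lam n p) (blockE n)

/-- The column `(1, 0, …, 0)ᵀ`. -/
def e1 (n : ℕ) : Fin n → ℂ := fun j => if (j : ℕ) = 0 then 1 else 0

/-- The `n × n` matrix with rows `f_i λ_i`, `λ_i²`, `f_i λ_i³`, `λ_i⁴`, …
(the first row has Lean index `0`). -/
def matOne (f : ℕ → ℝ × ℝ → ℂ) (lam : ℕ → ℂ) (n : ℕ) (p : ℝ × ℝ) :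
    Matrix (Fin n) (Fin n) ℂ :=
  Matrix.of fun j i =>
    if Even (j : ℕ) then f i p * lam i ^ ((j : ℕ) + 1) else lam i ^ ((j : ℕ) + 1)

/-- The `n × n` matrix with rows `λ_i`, `f_i λ_i²`, `λ_i³`, `f_i λ_i⁴`, … -/
def matF (f : ℕ → ℝ × ℝ → ℂ) (lam : ℕ → ℂ) (n : ℕ) (p : ℝ × ℝ) :
    Matrix (Fin n) (Fin n) ℂ :=
  Matrix.of fun j i =>
    if Even (j : ℕ) then lam i ^ ((j : ℕ) + 1) else f i p * lam i ^ ((j : ℕ) + 1)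

/-- The quasideterminant with rows `(1, …, 1, [0])` and `(matOne, e1)`. -/
def quasiOne (f : ℕ → ℝ × ℝ → ℂ) (lam : ℕ → ℂ) (n : ℕ) (p : ℝ × ℝ) : ℂ :=
  quasidetScalar (fun _ : Fin n => 1) 0 (matOne f lam n p) (e1 n)

/-- The quasideterminant with rows `(f_1, …, f_n, [0])` and `(matF, e1)`. -/
def quasiF (f : ℕ → ℝ × ℝ → ℂ) (lam : ℕ → ℂ) (n : ℕ) (p : ℝ × ℝ) : ℂ :=
  quasidetScalar (fun i : Fin n => f i p) 0 (matF f lam n p) (e1 n)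

/-- The explicit `q_{[n+1]}`. -/
def qNew (q r : ℝ × ℝ → ℂ) (f : ℕ → ℝ × ℝ → ℂ) (lam : ℕ → ℂ) (n : ℕ) (p : ℝ × ℝ) : ℂ :=
  if Odd n then r p + dx (quasiF f lam n) p else q p + dx (quasiOne f lam n) p

/-- The explicit `r_{[n+1]}`. -/
def rNew (q r : ℝ × ℝ → ℂ) (f : ℕ → ℝ × ℝ → ℂ) (lam : ℕ → ℂ) (n : ℕ) (p : ℝ × ℝ) : ℂ :=
  if Odd n then q p + dx (quasiOne f lam n) p else r p + dx (quasiF f lam n) p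

end

end DNLS

open Matrix
open scoped ContDiff

namespace DNLS

noncomputable section

/-! ### Partial derivatives on an open set -/

section Calculus

variable {m : WithTop ℕ∞} {D : Set (ℝ × ℝ)} {g h : ℝ × ℝ → ℂ} {p : ℝ × ℝ}

/-! A matrix eigenfunction `θ` has columns `φ (1, f)` and `φ' (1, -f)`, belonging to the parameters
`λ` and `-λ`. Hence `θ Λ⁻¹ θ⁻¹` is antidiagonal with entries `λ⁻¹ / f` and `λ⁻¹ f`: the factors `φ`,
`φ'` cancel, and only the ratio of the components matters. So everything reduces to vectors `(u, v)`
solving the Lax pair up to scalar terms, starting from `(1, f i)`, and the Riccati equations are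
exactly what is needed.

With the factors `σ` removed, one step sends `(u, v)` to `(u - (μ/l) W v, v - (μ/l) F u)`, where `F`
is the ratio `v / u` of the seed vector and `W = 1 / F`, and it turns the system for `c` into the
system for `-c`. This covariance (`IsSol.darboux`, `IsLax.darboux`) is a direct computation, halved
by the symmetry `q ↔ r`, `c ↔ -c`. The factors `σ` undo the sign change: for odd `n` they exchange
the two potentials.

After `k` steps the vectors are values of a matrix polynomial in the spectral parameter, with
constant term the identity and coefficients alternately diagonal and antidiagonal (`eig_eq_sum`). It
annihilates the first `k` seeds (`Nondegenerate.eig_eq_zero`). These linear equations determine the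
coefficients, with matrices `matOne` and `matF`, so both kinds of quasideterminant are the
coefficients of degree one. Since each step subtracts from the potentials the derivative of
precisely what it subtracts from these coefficients, the formulas telescope (`potPair_eq`).

Finally, the chain can be run at a point exactly when all `matOne`, `matF` up to size `n` are
invertible there (`nondegenerate_of_isUnit`, `Nondegenerate.isUnit`), which links the two halves of
the theorem. -/

lemma slice_x_eventually_mem (hD : IsOpen D) (hp : p ∈ D) :
    ∀ᶠ s in nhds p.1, ((s, p.2) : ℝ × ℝ) ∈ D :=
  (Continuous.prodMk_left p.2).continuousAt.preimage_mem_nhds (hD.mem_nhds hp)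

lemma slice_t_eventually_mem (hD : IsOpen D) (hp : p ∈ D) :
    ∀ᶠ s in nhds p.2, ((p.1, s) : ℝ × ℝ) ∈ D :=
  (Continuous.prodMk_right p.1).continuousAt.preimage_mem_nhds (hD.mem_nhds hp)

lemma dx_congr (hD : IsOpen D) (hgh : ∀ p ∈ D, g p = h p) (hp : p ∈ D) : dx g p = dx h p :=
  Filter.EventuallyEq.deriv_eq ((slice_x_eventually_mem hD hp).mono fun _ hs => hgh _ hs)

lemma dt_congr (hD : IsOpen D) (hgh : ∀ p ∈ D, g p = h p) (hp : p ∈ D) : dt g p = dt h p :=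
  Filter.EventuallyEq.deriv_eq ((slice_t_eventually_mem hD hp).mono fun _ hs => hgh _ hs)

lemma hasDerivAt_slice_x (hD : IsOpen D) (hg : ContDiffOn ℝ m g D) (hm : m ≠ 0) (hp : p ∈ D) :
    HasDerivAt (fun s : ℝ => g (s, p.2)) (fderiv ℝ g p (1, 0)) p.1 := by
  have h1 : HasFDerivAt g (fderiv ℝ g p) (p.1, p.2) :=
    ((hg.differentiableOn hm).differentiableAt (hD.mem_nhds hp)).hasFDerivAt
  exact h1.comp_hasDerivAt p.1 ((hasDerivAt_id p.1).prodMk (hasDerivAt_const p.1 p.2))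

lemma hasDerivAt_slice_t (hD : IsOpen D) (hg : ContDiffOn ℝ m g D) (hm : m ≠ 0) (hp : p ∈ D) :
    HasDerivAt (fun s : ℝ => g (p.1, s)) (fderiv ℝ g p (0, 1)) p.2 := by
  have h1 : HasFDerivAt g (fderiv ℝ g p) (p.1, p.2) :=
    ((hg.differentiableOn hm).differentiableAt (hD.mem_nhds hp)).hasFDerivAt
  exact h1.comp_hasDerivAt p.2 ((hasDerivAt_const p.2 p.1).prodMk (hasDerivAt_id p.2))

lemma hasDerivAt_dx (hD : IsOpen D) (hg : ContDiffOn ℝ m g D) (hm : m ≠ 0) (hp : p ∈ D) :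
    HasDerivAt (fun s : ℝ => g (s, p.2)) (dx g p) p.1 :=
  (hasDerivAt_slice_x hD hg hm hp).differentiableAt.hasDerivAt

lemma hasDerivAt_dt (hD : IsOpen D) (hg : ContDiffOn ℝ m g D) (hm : m ≠ 0) (hp : p ∈ D) :
    HasDerivAt (fun s : ℝ => g (p.1, s)) (dt g p) p.2 :=
  (hasDerivAt_slice_t hD hg hm hp).differentiableAt.hasDerivAt

lemma contDiffOn_dx (hD : IsOpen D) (hg : ContDiffOn ℝ m g D) (hm : 2 ≤ m) :
    ContDiffOn ℝ 1 (dx g) D := by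
  have h2 : ContDiffOn ℝ 1 (fderiv ℝ g) D := hg.fderiv_of_isOpen hD (by
    have : (1 : WithTop ℕ∞) + 1 = 2 := by norm_num
    rw [this]; exact hm)
  refine (h2.clm_apply (contDiffOn_const (c := ((1, 0) : ℝ × ℝ)))).congr fun p hp => ?_
  exact (hasDerivAt_slice_x hD hg (by rintro rfl; simp at hm) hp).deriv

lemma dx_eq_of_hasDerivAt {g' : ℂ} (hg : HasDerivAt (fun s : ℝ => g (s, p.2)) g' p.1) :
    dx g p = g' := hg.deriv

lemma dt_eq_of_hasDerivAt {g' : ℂ} (hg : HasDerivAt (fun s : ℝ => g (p.1, s)) g' p.2) :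
    dt g p = g' := hg.deriv

end Calculus

/-! ### The system with a square root `c` of `-1` in place of `i` -/

/-- `q_t = c q_xx + (q² r)_x`, `r_t = -c r_xx + (r² q)_x`. -/
structure IsSol (m : WithTop ℕ∞) (D : Set (ℝ × ℝ)) (c : ℂ) (q r : ℝ × ℝ → ℂ) : Prop where
  contDiff_q : ContDiffOn ℝ m q D
  contDiff_r : ContDiffOn ℝ m r D
  eq_q : ∀ p ∈ D, dt q p = c * dx (dx q) p + 2 * q p * r p * dx q p + q p ^ 2 * dx r p
  eq_r : ∀ p ∈ D, dt r p = -c * dx (dx r) p + 2 * r p * q p * dx r p + r p ^ 2 * dx q p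

/-- The vector `(u, v)` solves the Lax pair with spectral parameter `l`, up to the addition of
scalar functions `κ`, `τ` to its two matrices. -/
structure IsLax (m : WithTop ℕ∞) (D : Set (ℝ × ℝ)) (c : ℂ) (q r : ℝ × ℝ → ℂ) (l : ℂ)
    (κ τ u v : ℝ × ℝ → ℂ) : Prop where
  contDiff_u : ContDiffOn ℝ m u D
  contDiff_v : ContDiffOn ℝ m v D
  x_u : ∀ p ∈ D, dx u p = -c * l ^ 2 * u p + l * q p * v p + κ p * u p
  x_v : ∀ p ∈ D, dx v p = c * l ^ 2 * v p + l * r p * u p + κ p * v p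
  t_u : ∀ p ∈ D, dt u p = -2 * c * l ^ 4 * u p + 2 * l ^ 3 * q p * v p
    - c * q p * r p * l ^ 2 * u p + l * (c * dx q p + r p * q p ^ 2) * v p + τ p * u p
  t_v : ∀ p ∈ D, dt v p = 2 * c * l ^ 4 * v p + 2 * l ^ 3 * r p * u p
    + c * r p * q p * l ^ 2 * v p + l * (-c * dx r p + q p * r p ^ 2) * u p + τ p * v p

/-- The Riccati equations satisfied by the quotient `v / u`. -/
structure IsRic (m : WithTop ℕ∞) (D : Set (ℝ × ℝ)) (c : ℂ) (q r : ℝ × ℝ → ℂ) (l : ℂ)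
    (F : ℝ × ℝ → ℂ) : Prop where
  contDiff : ContDiffOn ℝ m F D
  eq_x : ∀ p ∈ D, dx F p = 2 * c * l ^ 2 * F p + l * r p - l * q p * F p ^ 2
  eq_t : ∀ p ∈ D, dt F p = (4 * c * l ^ 4 + 2 * c * q p * r p * l ^ 2) * F p
    + 2 * l ^ 3 * r p + l * (-c * dx r p + q p * r p ^ 2)
    - (2 * l ^ 3 * q p + l * (c * dx q p + r p * q p ^ 2)) * F p ^ 2

/-! ### A single Darboux step -/

section Step

variable {m : WithTop ℕ∞} {D : Set (ℝ × ℝ)} {c : ℂ} {q r : ℝ × ℝ → ℂ} {l μ : ℂ}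
  {κ τ u v F W : ℝ × ℝ → ℂ}

/-- This symmetry, with its analogue for `IsLax`, lets every later computation treat the second
component only. -/
lemma IsSol.swap (h : IsSol m D c q r) : IsSol m D (-c) r q :=
  ⟨h.contDiff_r, h.contDiff_q, h.eq_r, by simpa using h.eq_q⟩

lemma IsLax.swap (h : IsLax m D c q r l κ τ u v) : IsLax m D (-c) r q l κ τ v u where
  contDiff_u := h.contDiff_v
  contDiff_v := h.contDiff_u
  x_u p hp := by rw [h.x_v p hp]; ring
  x_v p hp := by rw [h.x_u p hp]
  t_u p hp := by rw [h.t_v p hp]; ring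
  t_v p hp := by rw [h.t_u p hp]; ring

/-- The scalar terms `κ`, `τ` rescale `u` and `v` alike, so they drop out of the quotient. -/
lemma IsLax.isRic (hD : IsOpen D) (hm : m ≠ 0) (h : IsLax m D c q r l κ τ u v)
    (hu : ∀ p ∈ D, u p ≠ 0) : IsRic m D c q r l (fun p => v p / u p) where
  contDiff := by
    exact (h.contDiff_v.mul (h.contDiff_u.inv hu)).congr fun p _ => div_eq_mul_inv _ _
  eq_x p hp := by
    have hu' := hu p hp
    rw [dx_eq_of_hasDerivAt ((hasDerivAt_dx hD h.contDiff_v hm hp).fun_div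
      (hasDerivAt_dx hD h.contDiff_u hm hp) hu'), h.x_u p hp, h.x_v p hp]
    simp only [Prod.mk.eta]
    field_simp
    ring
  eq_t p hp := by
    have hu' := hu p hp
    rw [dt_eq_of_hasDerivAt ((hasDerivAt_dt hD h.contDiff_v hm hp).fun_div
      (hasDerivAt_dt hD h.contDiff_u hm hp) hu'), h.t_u p hp, h.t_v p hp]
    simp only [Prod.mk.eta]
    field_simp
    ring

/-- The second component of the Darboux transform of the potential. -/
def darbouxR (c : ℂ) (q : ℝ × ℝ → ℂ) (l : ℂ) (F : ℝ × ℝ → ℂ) (p : ℝ × ℝ) : ℂ :=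
  q p * F p ^ 2 - 2 * c * l * F p

/-- The derivative-free form of the transform is what preserves the class `C^m`; the equivalent `r -
F_x / l` would seem to lose one derivative. -/
lemma contDiffOn_darbouxR (hq : ContDiffOn ℝ m q D) (hF : ContDiffOn ℝ m F D) :
    ContDiffOn ℝ m (darbouxR c q l F) D :=
  (hq.mul (hF.pow 2)).sub (contDiffOn_const.mul hF)

lemma dx_darbouxR (hD : IsOpen D) (hm : m ≠ 0) (hq : ContDiffOn ℝ m q D)
    (hF : IsRic m D c q r l F) {p : ℝ × ℝ} (hp : p ∈ D) :
    dx (darbouxR c q l F) p = dx q p * F p ^ 2 + (2 * q p * F p - 2 * c * l)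
      * (2 * c * l ^ 2 * F p + l * r p - l * q p * F p ^ 2) := by
  have h1 := hasDerivAt_dx hD hq hm hp
  have h2 := hasDerivAt_dx hD hF.contDiff hm hp
  refine (dx_eq_of_hasDerivAt ((h1.fun_mul (h2.fun_pow 2)).fun_sub
    (h2.const_mul (2 * c * l)))).trans ?_
  rw [hF.eq_x p hp]
  push_cast
  ring

lemma dt_darbouxR (hD : IsOpen D) (hm : m ≠ 0) (hq : ContDiffOn ℝ m q D)
    (hF : ContDiffOn ℝ m F D) {p : ℝ × ℝ} (hp : p ∈ D) :
    dt (darbouxR c q l F) p = dt q p * F p ^ 2 + (2 * q p * F p - 2 * c * l) * dt F p := by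
  have h1 := hasDerivAt_dt hD hq hm hp
  have h2 := hasDerivAt_dt hD hF hm hp
  refine (dt_eq_of_hasDerivAt ((h1.fun_mul (h2.fun_pow 2)).fun_sub
    (h2.const_mul (2 * c * l)))).trans ?_
  push_cast
  ring

lemma dx_dx_darbouxR (hD : IsOpen D) (hm : 2 ≤ m) (hq : ContDiffOn ℝ m q D)
    (hr : ContDiffOn ℝ m r D) (hF : IsRic m D c q r l F) {p : ℝ × ℝ} (hp : p ∈ D) :
    dx (dx (darbouxR c q l F)) p =
      dx (dx q) p * F p ^ 2 + 2 * dx q p * F p * dx F p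
      + (2 * dx q p * F p + 2 * q p * dx F p)
          * (2 * c * l ^ 2 * F p + l * r p - l * q p * F p ^ 2)
      + (2 * q p * F p - 2 * c * l) * (2 * c * l ^ 2 * dx F p + l * dx r p
          - (l * dx q p * F p ^ 2 + 2 * l * q p * F p * dx F p)) := by
  have hm0 : m ≠ 0 := by rintro rfl; simp at hm
  -- The first derivative has already lost `F_x` through the Riccati equation, so only `q` is ever
  -- differentiated twice.
  rw [dx_congr hD (fun p hp => dx_darbouxR hD hm0 hq hF hp) hp]
  have h1 := hasDerivAt_dx hD hq hm0 hp
  have h2 := hasDerivAt_dx hD hF.contDiff hm0 hp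
  have h3 := hasDerivAt_dx hD hr hm0 hp
  have h4 := hasDerivAt_dx hD (contDiffOn_dx hD hq hm) one_ne_zero hp
  refine (dx_eq_of_hasDerivAt ((h4.fun_mul (h2.fun_pow 2)).fun_add
    ((((h1.const_mul 2).fun_mul h2).sub_const (2 * c * l)).fun_mul
      (((h2.const_mul (2 * c * l ^ 2)).fun_add (h3.const_mul l)).fun_sub
        ((h1.const_mul l).fun_mul (h2.fun_pow 2)))))).trans ?_
  push_cast
  ring

/-- The Riccati equations and the equation for `q_t` eliminate all derivatives except `q_x`, `r_x`,
`q_xx`. What remains is a rational identity in independent quantities, valid modulo `c² = -1`. -/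
lemma IsSol.darboux_eq (hD : IsOpen D) (hm : 2 ≤ m) (hc : c ^ 2 = -1) (h : IsSol m D c q r)
    (hF : IsRic m D c q r l F) (hW : IsRic m D (-c) r q l W) {p : ℝ × ℝ} (hp : p ∈ D)
    (hFW : F p * W p = 1) :
    dt (darbouxR c q l F) p = c * dx (dx (darbouxR c q l F)) p
      + 2 * darbouxR c q l F p * darbouxR (-c) r l W p * dx (darbouxR c q l F) p
      + darbouxR c q l F p ^ 2 * dx (darbouxR (-c) r l W) p := by
  have hm0 : m ≠ 0 := by rintro rfl; simp at hm
  rw [dt_darbouxR hD hm0 h.contDiff_q hF.contDiff hp,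
    dx_dx_darbouxR hD hm h.contDiff_q h.contDiff_r hF hp, dx_darbouxR hD hm0 h.contDiff_q hF hp,
    dx_darbouxR hD hm0 h.contDiff_r hW hp, hF.eq_t p hp, hF.eq_x p hp, h.eq_q p hp]
  simp only [darbouxR]
  have hF0 : F p ≠ 0 := left_ne_zero_of_mul_eq_one hFW
  have hW' : W p = (F p)⁻¹ := eq_inv_of_mul_eq_one_right hFW
  rw [hW']
  generalize F p = F, q p = q, r p = r, dx q p = qx, dx r p = rx, dx (dx q) p = qxx at *
  -- `ring` does not know `c² = -1`, so the powers of `c` are reduced by hand after normalization.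
  have hc3 : c ^ 3 = -c := by rw [pow_succ, hc]; ring
  have hc4 : c ^ 4 = 1 := by rw [show c ^ 4 = (c ^ 2) ^ 2 by ring, hc]; ring
  field_simp
  ring_nf
  simp only [hc, hc3, hc4]
  ring

lemma IsSol.darboux (hD : IsOpen D) (hm : 2 ≤ m) (hc : c ^ 2 = -1) (h : IsSol m D c q r)
    (hF : IsRic m D c q r l F) (hW : IsRic m D (-c) r q l W)
    (hFW : ∀ p ∈ D, F p * W p = 1) :
    IsSol m D (-c) (darbouxR (-c) r l W) (darbouxR c q l F) where
  contDiff_q := contDiffOn_darbouxR h.contDiff_r hW.contDiff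
  contDiff_r := contDiffOn_darbouxR h.contDiff_q hF.contDiff
  eq_q p hp := by
    have hWF : W p * F p = 1 := by rw [mul_comm]; exact hFW p hp
    have h1 := h.swap.darboux_eq hD hm (by rw [neg_sq, hc]) hW (W := F) (by rwa [neg_neg]) hp hWF
    rw [neg_neg] at h1
    exact h1
  eq_r p hp := by
    have h1 := h.darboux_eq hD hm hc hF hW hp (hFW p hp)
    rw [neg_neg]
    exact h1

lemma IsLax.darboux_eq_x (hD : IsOpen D) (hm : 2 ≤ m) (hl : l ≠ 0)
    (h : IsLax m D c q r μ κ τ u v)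
    (hF : IsRic m D c q r l F) {p : ℝ × ℝ} (hp : p ∈ D) (hFW : F p * W p = 1) :
    dx (fun p => v p - μ / l * F p * u p) p =
      -c * μ ^ 2 * (v p - μ / l * F p * u p)
      + μ * darbouxR c q l F p * (u p - μ / l * W p * v p)
      + κ p * (v p - μ / l * F p * u p) := by
  have hm0 : m ≠ 0 := by rintro rfl; simp at hm
  have h1 := hasDerivAt_dx hD hF.contDiff hm0 hp
  have h2 := hasDerivAt_dx hD h.contDiff_u hm0 hp
  have h3 := hasDerivAt_dx hD h.contDiff_v hm0 hp
  refine (dx_eq_of_hasDerivAt (h3.fun_sub ((h1.const_mul (μ / l)).fun_mul h2))).trans ?_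
  rw [hF.eq_x p hp, h.x_u p hp, h.x_v p hp]
  simp only [darbouxR]
  have hF0 : F p ≠ 0 := left_ne_zero_of_mul_eq_one hFW
  have hW' : W p = (F p)⁻¹ := eq_inv_of_mul_eq_one_right hFW
  rw [hW']
  field_simp
  ring

lemma IsLax.darboux_eq_t (hD : IsOpen D) (hm : 2 ≤ m) (hl : l ≠ 0) (hc : c ^ 2 = -1)
    (h : IsLax m D c q r μ κ τ u v) (hq : ContDiffOn ℝ m q D)
    (hF : IsRic m D c q r l F) {p : ℝ × ℝ} (hp : p ∈ D) (hFW : F p * W p = 1) :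
    dt (fun p => v p - μ / l * F p * u p) p =
      -2 * c * μ ^ 4 * (v p - μ / l * F p * u p)
      + 2 * μ ^ 3 * darbouxR c q l F p * (u p - μ / l * W p * v p)
      - c * darbouxR (-c) r l W p * darbouxR c q l F p * μ ^ 2 * (v p - μ / l * F p * u p)
      + μ * (c * dx (darbouxR c q l F) p + darbouxR (-c) r l W p * darbouxR c q l F p ^ 2)
        * (u p - μ / l * W p * v p)
      + τ p * (v p - μ / l * F p * u p) := by
  have hm0 : m ≠ 0 := by rintro rfl; simp at hm
  have h1 := hasDerivAt_dt hD hF.contDiff hm0 hp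
  have h2 := hasDerivAt_dt hD h.contDiff_u hm0 hp
  have h3 := hasDerivAt_dt hD h.contDiff_v hm0 hp
  refine (dt_eq_of_hasDerivAt (h3.fun_sub ((h1.const_mul (μ / l)).fun_mul h2))).trans ?_
  rw [hF.eq_t p hp, h.t_u p hp, h.t_v p hp, dx_darbouxR hD hm0 hq hF hp]
  simp only [darbouxR]
  have hF0 : F p ≠ 0 := left_ne_zero_of_mul_eq_one hFW
  have hW' : W p = (F p)⁻¹ := eq_inv_of_mul_eq_one_right hFW
  rw [hW']
  generalize F p = F, q p = q, r p = r, dx q p = qx, dx r p = rx, u p = u, v p = v at *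
  have hc3 : c ^ 3 = -c := by rw [pow_succ, hc]; ring
  field_simp
  ring_nf
  simp only [hc, hc3]
  ring

/-- The step acts linearly on `(u, v)`, so the same scalar terms `κ`, `τ` serve before and after it.
-/
lemma IsLax.darboux (hD : IsOpen D) (hm : 2 ≤ m) (hl : l ≠ 0) (hc : c ^ 2 = -1)
    (h : IsLax m D c q r μ κ τ u v) (hqr : IsSol m D c q r)
    (hF : IsRic m D c q r l F) (hW : IsRic m D (-c) r q l W)
    (hFW : ∀ p ∈ D, F p * W p = 1) :
    IsLax m D (-c) (darbouxR (-c) r l W) (darbouxR c q l F) μ κ τ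
      (fun p => u p - μ / l * W p * v p) (fun p => v p - μ / l * F p * u p) where
  contDiff_u := h.contDiff_u.sub ((contDiffOn_const.mul hW.contDiff).mul h.contDiff_v)
  contDiff_v := h.contDiff_v.sub ((contDiffOn_const.mul hF.contDiff).mul h.contDiff_u)
  x_u p hp := by
    have hWF : W p * F p = 1 := by rw [mul_comm]; exact hFW p hp
    have h1 := h.swap.darboux_eq_x hD hm hl hW hp hWF
    linear_combination h1
  x_v p hp := by
    have h1 := h.darboux_eq_x hD hm hl hF hp (hFW p hp)
    linear_combination h1
  t_u p hp := by
    have hWF : W p * F p = 1 := by rw [mul_comm]; exact hFW p hp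
    have h1 := h.swap.darboux_eq_t hD hm hl (by rw [neg_sq, hc]) hqr.contDiff_r hW hp hWF
    rw [neg_neg] at h1
    rw [h1]
    ring
  t_v p hp := by
    have h1 := h.darboux_eq_t hD hm hl hc hqr.contDiff_q hF hp (hFW p hp)
    rw [h1]
    ring

/-- The Darboux transform of the potential in terms of derivatives of `F` and `W`. -/
lemma IsRic.darbouxR_eq (hl : l ≠ 0) (hF : IsRic m D c q r l F) {p : ℝ × ℝ} (hp : p ∈ D) :
    darbouxR c q l F p = r p - dx (fun p => l⁻¹ * F p) p := by
  have : dx (fun p => l⁻¹ * F p) p = l⁻¹ * dx F p := deriv_const_mul_field _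
  rw [this, hF.eq_x p hp, darbouxR]
  field_simp
  ring

end Step

/-! ### The iterated Darboux transformation of vectors -/

/-- The components `(u, v)` of the `k`-fold Darboux transform of the vector `(1, f i)`, without
the factors `sigma`. -/
def eigPair (f : ℕ → ℝ × ℝ → ℂ) (lam : ℕ → ℂ) : ℕ → ℕ → ℝ × ℝ → ℂ × ℂ
  | 0, i, p => (1, f i p)
  | k + 1, i, p =>
      ((eigPair f lam k i p).1 - lam i / lam k
          * ((eigPair f lam k k p).1 / (eigPair f lam k k p).2) * (eigPair f lam k i p).2,
        (eigPair f lam k i p).2 - lam i / lam k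
          * ((eigPair f lam k k p).2 / (eigPair f lam k k p).1) * (eigPair f lam k i p).1)

/-- The first component of `eigPair`. -/
def eigU (f : ℕ → ℝ × ℝ → ℂ) (lam : ℕ → ℂ) (k i : ℕ) (p : ℝ × ℝ) : ℂ := (eigPair f lam k i p).1

/-- The second component of `eigPair`. -/
def eigV (f : ℕ → ℝ × ℝ → ℂ) (lam : ℕ → ℂ) (k i : ℕ) (p : ℝ × ℝ) : ℂ := (eigPair f lam k i p).2

/-- The coefficients of the two rows of the `k`-fold Darboux matrix, as a polynomial in the
spectral parameter. -/
def coefPair (f : ℕ → ℝ × ℝ → ℂ) (lam : ℕ → ℂ) : ℕ → ℝ × ℝ → ℕ → ℂ × ℂ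
  | 0, _, 0 => (1, 1)
  | 0, _, _ + 1 => (0, 0)
  | k + 1, p, 0 => coefPair f lam k p 0
  | k + 1, p, j + 1 =>
      ((coefPair f lam k p (j + 1)).1 - (lam k)⁻¹ * (eigU f lam k k p / eigV f lam k k p)
          * (coefPair f lam k p j).2,
        (coefPair f lam k p (j + 1)).2 - (lam k)⁻¹ * (eigV f lam k k p / eigU f lam k k p)
          * (coefPair f lam k p j).1)

/-- The coefficients of the first row of the Darboux matrix. -/
def coefU (f : ℕ → ℝ × ℝ → ℂ) (lam : ℕ → ℂ) (k : ℕ) (p : ℝ × ℝ) (j : ℕ) : ℂ :=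
  (coefPair f lam k p j).1

/-- The coefficients of the second row of the Darboux matrix. -/
def coefV (f : ℕ → ℝ × ℝ → ℂ) (lam : ℕ → ℂ) (k : ℕ) (p : ℝ × ℝ) (j : ℕ) : ℂ :=
  (coefPair f lam k p j).2

section Algebra

variable (f : ℕ → ℝ × ℝ → ℂ) (lam : ℕ → ℂ) (k i j : ℕ) (p : ℝ × ℝ)

lemma eigU_zero : eigU f lam 0 i p = 1 := rfl

lemma eigV_zero : eigV f lam 0 i p = f i p := rfl

lemma eigU_succ : eigU f lam (k + 1) i p = eigU f lam k i p
    - lam i / lam k * (eigU f lam k k p / eigV f lam k k p) * eigV f lam k i p := rfl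

lemma eigV_succ : eigV f lam (k + 1) i p = eigV f lam k i p
    - lam i / lam k * (eigV f lam k k p / eigU f lam k k p) * eigU f lam k i p := rfl

lemma coefU_succ : coefU f lam (k + 1) p (j + 1) = coefU f lam k p (j + 1)
    - (lam k)⁻¹ * (eigU f lam k k p / eigV f lam k k p) * coefV f lam k p j := rfl

lemma coefV_succ : coefV f lam (k + 1) p (j + 1) = coefV f lam k p (j + 1)
    - (lam k)⁻¹ * (eigV f lam k k p / eigU f lam k k p) * coefU f lam k p j := rfl

lemma coefPair_zero_right : coefPair f lam k p 0 = (1, 1) := by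
  induction k with
  | zero => rfl
  | succ k ih => exact ih

lemma coefU_zero_right : coefU f lam k p 0 = 1 := by rw [coefU, coefPair_zero_right]

lemma coefV_zero_right : coefV f lam k p 0 = 1 := by rw [coefV, coefPair_zero_right]

lemma coefPair_eq_zero {j : ℕ} (h : k < j) : coefPair f lam k p j = (0, 0) := by
  induction k generalizing j with
  | zero => obtain ⟨j, rfl⟩ : ∃ j', j = j' + 1 := ⟨j - 1, by omega⟩; rfl
  | succ k ih =>
    obtain ⟨j, rfl⟩ : ∃ j', j = j' + 1 := ⟨j - 1, by omega⟩
    rw [coefPair, ih (by omega : k < j + 1), ih (by omega : k < j)]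
    simp

lemma coefU_eq_zero {j : ℕ} (h : k < j) : coefU f lam k p j = 0 := by
  rw [coefU, coefPair_eq_zero f lam k p h]

lemma coefV_eq_zero {j : ℕ} (h : k < j) : coefV f lam k p j = 0 := by
  rw [coefV, coefPair_eq_zero f lam k p h]

/-- The transformed vectors are the values of the Darboux matrix at the spectral parameters. -/
lemma eig_eq_sum :
    eigU f lam k i p = ∑ j ∈ Finset.range (k + 1),
        coefU f lam k p j * (lam i ^ j * if Even j then 1 else f i p) ∧
      eigV f lam k i p = ∑ j ∈ Finset.range (k + 1),
        coefV f lam k p j * (lam i ^ j * if Even j then f i p else 1) := by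
  induction k with
  | zero => simp [eigU_zero, eigV_zero, coefU_zero_right, coefV_zero_right]
  | succ k ih =>
    obtain ⟨hU, hV⟩ := ih
    have hU' := hU
    have hV' := hV
    -- The coefficient of degree `k + 1` vanishes after `k` steps, so a zero term may be appended to
    -- match the range of the next sum.
    rw [← add_zero (Finset.sum _ _), ← zero_mul (lam i ^ (k + 1) * if Even (k + 1) then 1 else f i p),
      ← coefU_eq_zero f lam k p (Nat.lt_succ_self k), ← Finset.sum_range_succ] at hU'
    rw [← add_zero (Finset.sum _ _), ← zero_mul (lam i ^ (k + 1) * if Even (k + 1) then f i p else 1),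
      ← coefV_eq_zero f lam k p (Nat.lt_succ_self k), ← Finset.sum_range_succ] at hV'
    rw [Finset.sum_range_succ'] at hU' hV'
    rw [eigU_succ, eigV_succ, Finset.sum_range_succ' _ (k + 1), Finset.sum_range_succ' _ (k + 1)]
    constructor
    -- Multiplication by `lam i` raises the degree by one, which flips the parity and thus turns the
    -- monomials of `eigV` into those of `eigU`.
    · have key : ∑ j ∈ Finset.range (k + 1), coefU f lam (k + 1) p (j + 1)
            * (lam i ^ (j + 1) * if Even (j + 1) then 1 else f i p)
          = ∑ j ∈ Finset.range (k + 1), coefU f lam k p (j + 1)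
            * (lam i ^ (j + 1) * if Even (j + 1) then 1 else f i p)
          - lam i / lam k * (eigU f lam k k p / eigV f lam k k p) * eigV f lam k i p := by
        rw [hV, Finset.mul_sum, ← Finset.sum_sub_distrib]
        refine Finset.sum_congr rfl fun j _ => ?_
        simp only [coefU_succ, Nat.even_add_one]
        split_ifs <;> first | contradiction | ring
      rw [key, hU', coefU_zero_right, coefU_zero_right]
      ring
    · have key : ∑ j ∈ Finset.range (k + 1), coefV f lam (k + 1) p (j + 1)
            * (lam i ^ (j + 1) * if Even (j + 1) then f i p else 1)
          = ∑ j ∈ Finset.range (k + 1), coefV f lam k p (j + 1)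
            * (lam i ^ (j + 1) * if Even (j + 1) then f i p else 1)
          - lam i / lam k * (eigV f lam k k p / eigU f lam k k p) * eigU f lam k i p := by
        rw [hU, Finset.mul_sum, ← Finset.sum_sub_distrib]
        refine Finset.sum_congr rfl fun j _ => ?_
        simp only [coefV_succ, Nat.even_add_one]
        split_ifs <;> first | contradiction | ring
      rw [key, hV', coefV_zero_right, coefV_zero_right]
      ring

/-- The rows of `matOne` are the monomials of degree `1, …, k` in the expansion of `eigU`; its
constant term is `1`. -/
lemma coefU_vecMul_matOne (i : Fin k) :
    ((fun j : Fin k => coefU f lam k p (j + 1)) ᵥ* matOne f lam k p) i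
      = eigU f lam k i p - 1 := by
  rw [(eig_eq_sum f lam k i p).1, Finset.sum_range_succ', ← Fin.sum_univ_eq_sum_range
    (fun j => coefU f lam k p (j + 1) * (lam i ^ (j + 1) * if Even (j + 1) then 1 else f i p)) k]
  simp only [coefU_zero_right, pow_zero, Even.zero, if_true, mul_one, add_sub_cancel_right]
  rw [Matrix.vecMul, dotProduct]
  refine Finset.sum_congr rfl fun j _ => ?_
  simp only [matOne, Matrix.of_apply, Nat.even_add_one]
  split_ifs <;> ring

lemma coefV_vecMul_matF (i : Fin k) :
    ((fun j : Fin k => coefV f lam k p (j + 1)) ᵥ* matF f lam k p) i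
      = eigV f lam k i p - f i p := by
  rw [(eig_eq_sum f lam k i p).2, Finset.sum_range_succ', ← Fin.sum_univ_eq_sum_range
    (fun j => coefV f lam k p (j + 1) * (lam i ^ (j + 1) * if Even (j + 1) then f i p else 1)) k]
  simp only [coefV_zero_right, pow_zero, Even.zero, if_true, one_mul, add_sub_cancel_right]
  rw [Matrix.vecMul, dotProduct]
  refine Finset.sum_congr rfl fun j _ => ?_
  simp only [matF, Matrix.of_apply, Nat.even_add_one]
  split_ifs <;> ring

/-- The same monomials are also `lam i` times those of degree `0, …, k` in the expansion of `eigV`.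
This second reading governs invertibility. -/
lemma coefV_vecMul_matOne (i : Fin (k + 1)) :
    ((fun j : Fin (k + 1) => coefV f lam k p j) ᵥ* matOne f lam (k + 1) p) i
      = lam i * eigV f lam k i p := by
  rw [(eig_eq_sum f lam k i p).2, ← Fin.sum_univ_eq_sum_range
    (fun j => coefV f lam k p j * (lam i ^ j * if Even j then f i p else 1)), Finset.mul_sum]
  rw [Matrix.vecMul, dotProduct]
  refine Finset.sum_congr rfl fun j _ => ?_
  simp only [matOne, Matrix.of_apply]
  split_ifs <;> ring

lemma coefU_vecMul_matF (i : Fin (k + 1)) :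
    ((fun j : Fin (k + 1) => coefU f lam k p j) ᵥ* matF f lam (k + 1) p) i
      = lam i * eigU f lam k i p := by
  rw [(eig_eq_sum f lam k i p).1, ← Fin.sum_univ_eq_sum_range
    (fun j => coefU f lam k p j * (lam i ^ j * if Even j then 1 else f i p)), Finset.mul_sum]
  rw [Matrix.vecMul, dotProduct]
  refine Finset.sum_congr rfl fun j _ => ?_
  simp only [matF, Matrix.of_apply]
  split_ifs <;> ring

/-- The first `k` Darboux steps are defined at `p`. -/
def Nondegenerate (f : ℕ → ℝ × ℝ → ℂ) (lam : ℕ → ℂ) (k : ℕ) (p : ℝ × ℝ) : Prop :=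
  ∀ j < k, eigU f lam j j p ≠ 0 ∧ eigV f lam j j p ≠ 0

/-! ### Nondegeneracy of the chain and invertibility of the two matrices -/

variable {f lam k p}

lemma Nondegenerate.mono {k' : ℕ} (h : Nondegenerate f lam k p) (hk : k' ≤ k) :
    Nondegenerate f lam k' p := fun j hj => h j (hj.trans_le hk)

/-- Step `i` annihilates its own seed vector, and later steps are linear. -/
lemma Nondegenerate.eig_eq_zero (h : Nondegenerate f lam k p) (hlam : ∀ i < k, lam i ≠ 0)
    {i : ℕ} (hi : i < k) : eigU f lam k i p = 0 ∧ eigV f lam k i p = 0 := by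
  induction k with
  | zero => omega
  | succ k ih =>
    obtain ⟨hu, hv⟩ := h k (Nat.lt_succ_self k)
    have hl := hlam k (Nat.lt_succ_self k)
    rw [eigU_succ, eigV_succ]
    rcases Nat.lt_succ_iff_lt_or_eq.mp hi with hi | rfl
    · obtain ⟨h1, h2⟩ := ih (h.mono (Nat.le_succ k)) (fun i hi => hlam i (by omega)) hi
      simp [h1, h2]
    · constructor <;> field_simp <;> ring

/-- Otherwise the coefficient vector of `eigV`, whose first entry is `1`, would lie in the left
kernel of `matOne`. -/
lemma eigV_ne_zero_of_isUnit_matOne (hA : IsUnit (matOne f lam (k + 1) p))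
    (h : Nondegenerate f lam k p) (hlam : ∀ i < k, lam i ≠ 0) : eigV f lam k k p ≠ 0 := by
  intro h0
  have hw : (fun j : Fin (k + 1) => coefV f lam k p j) = 0 := by
    refine Matrix.vecMul_injective_iff_isUnit.mpr hA ?_
    simp only [Matrix.zero_vecMul]
    funext i
    rw [coefV_vecMul_matOne]
    rcases Nat.lt_succ_iff_lt_or_eq.mp i.2 with hi | hi
    · simp [(h.eig_eq_zero hlam hi).2]
    · simp [hi, h0]
  simpa [coefV_zero_right] using congrFun hw 0

lemma eigU_ne_zero_of_isUnit_matF (hB : IsUnit (matF f lam (k + 1) p))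
    (h : Nondegenerate f lam k p) (hlam : ∀ i < k, lam i ≠ 0) : eigU f lam k k p ≠ 0 := by
  intro h0
  have hw : (fun j : Fin (k + 1) => coefU f lam k p j) = 0 := by
    refine Matrix.vecMul_injective_iff_isUnit.mpr hB ?_
    simp only [Matrix.zero_vecMul]
    funext i
    rw [coefU_vecMul_matF]
    rcases Nat.lt_succ_iff_lt_or_eq.mp i.2 with hi | hi
    · simp [(h.eig_eq_zero hlam hi).1]
    · simp [hi, h0]
  simpa [coefU_zero_right] using congrFun hw 0

lemma nondegenerate_of_isUnit (hlam : ∀ i < k, lam i ≠ 0)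
    (h : ∀ j ≤ k, IsUnit (matOne f lam j p) ∧ IsUnit (matF f lam j p)) :
    Nondegenerate f lam k p := by
  induction k with
  | zero => intro j hj; omega
  | succ k ih =>
    have hk := ih (fun i hi => hlam i (by omega)) (fun j hj => h j (by omega))
    intro j hj
    rcases Nat.lt_succ_iff_lt_or_eq.mp hj with hj | rfl
    · exact hk j hj
    · have hl : ∀ i < j, lam i ≠ 0 := fun i hi => hlam i (by omega)
      exact ⟨eigU_ne_zero_of_isUnit_matF (h _ le_rfl).2 hk hl,
        eigV_ne_zero_of_isUnit_matOne (h _ le_rfl).1 hk hl⟩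

/-- Below its first row, `matOne` of size `k + 1` restricts to `matF` of size `k` with columns
scaled by `lam i`; this drives the induction on size. -/
lemma vecMul_matOne_succ (w : Fin (k + 1) → ℂ) (i : Fin (k + 1)) :
    (w ᵥ* matOne f lam (k + 1) p) i = lam i * (w 0 * f i p
      + ∑ j : Fin k, w j.succ * if Even (j : ℕ) then lam i ^ ((j : ℕ) + 1)
          else f i p * lam i ^ ((j : ℕ) + 1)) := by
  rw [Matrix.vecMul, dotProduct, Fin.sum_univ_succ, mul_add, Finset.mul_sum]
  congr 1
  · simp [matOne]; ring
  · refine Finset.sum_congr rfl fun j _ => ?_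
    simp only [matOne, Matrix.of_apply, Fin.val_succ, Nat.even_add_one]
    split_ifs <;> first | contradiction | ring

lemma vecMul_matF_succ (w : Fin (k + 1) → ℂ) (i : Fin (k + 1)) :
    (w ᵥ* matF f lam (k + 1) p) i = lam i * (w 0
      + ∑ j : Fin k, w j.succ * if Even (j : ℕ) then f i p * lam i ^ ((j : ℕ) + 1)
          else lam i ^ ((j : ℕ) + 1)) := by
  rw [Matrix.vecMul, dotProduct, Fin.sum_univ_succ, mul_add, Finset.mul_sum]
  congr 1
  · simp [matF]; ring
  · refine Finset.sum_congr rfl fun j _ => ?_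
    simp only [matF, Matrix.of_apply, Fin.val_succ, Nat.even_add_one]
    split_ifs <;> first | contradiction | ring

/-- Subtracting from `w` the multiple of the coefficient vector with the same first entry. -/
lemma eq_zero_of_vecMul_eq_zero {w a : Fin (k + 1) → ℂ} {A : Matrix (Fin (k + 1)) (Fin (k + 1)) ℂ}
    {B : Matrix (Fin k) (Fin k) ℂ} {s e : ℕ → ℂ} (hB : IsUnit B) (ha : a 0 = 1)
    (hA : ∀ w : Fin (k + 1) → ℂ, w 0 = 0 → (∀ i : Fin k, (w ᵥ* A) i.castSucc = 0) →
      ∀ i, (Fin.tail w ᵥ* B) i = 0)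
    (hs : ∀ i : Fin (k + 1), (a ᵥ* A) i = s i * e i) (he : ∀ i < k, e i = 0)
    (hsk : s k ≠ 0) (hek : e k ≠ 0) (hw : w ᵥ* A = 0) : w = 0 := by
  have hinj := Matrix.vecMul_injective_iff_isUnit.mpr hB
  have tail_zero : ∀ w : Fin (k + 1) → ℂ, w 0 = 0 → (∀ i : Fin k, (w ᵥ* A) i.castSucc = 0) →
      w = 0 := by
    intro w h0 hw
    have ht : Fin.tail w = 0 := hinj (by
      simp only [Matrix.zero_vecMul]; exact funext (hA w h0 hw))
    funext j
    refine Fin.cases h0 (fun j => ?_) j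
    exact congrFun ht j
  -- `a ᵥ* A` vanishes except in its last entry `s k * e k`, so the difference meets the hypotheses
  -- of `tail_zero`. The last column then forces `w 0 = 0`.
  have h1 : w - w 0 • a = 0 := by
    refine tail_zero _ (by simp [ha]) fun i => ?_
    rw [Matrix.sub_vecMul, Matrix.smul_vecMul, hw]
    simp [hs, he]
  have h2 : w = w 0 • a := sub_eq_zero.mp h1
  have h3 : w 0 = 0 := by
    have h4 := congrFun hw (Fin.last k)
    rw [h2, Matrix.smul_vecMul, Pi.smul_apply, hs] at h4
    simpa [hsk, hek] using h4
  rw [h2, h3, zero_smul]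

lemma Nondegenerate.isUnit (hlam : ∀ i < k, lam i ≠ 0) (h : Nondegenerate f lam k p) :
    IsUnit (matOne f lam k p) ∧ IsUnit (matF f lam k p) := by
  induction k with
  | zero => exact ⟨isUnit_of_subsingleton _, isUnit_of_subsingleton _⟩
  | succ k ih =>
    have hlam' : ∀ i < k, lam i ≠ 0 := fun i hi => hlam i (by omega)
    have hk := h.mono (Nat.le_succ k)
    obtain ⟨hA, hB⟩ := ih hlam' hk
    obtain ⟨hu, hv⟩ := h k (Nat.lt_succ_self k)
    have hl := hlam k (Nat.lt_succ_self k)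
    have inj : ∀ A : Matrix (Fin (k + 1)) (Fin (k + 1)) ℂ, (∀ w, w ᵥ* A = 0 → w = 0) →
        IsUnit A := fun A hA => Matrix.vecMul_injective_iff_isUnit.mp fun x y hxy =>
      sub_eq_zero.mp (hA _ (by rw [Matrix.sub_vecMul]; exact sub_eq_zero.mpr hxy))
    constructor
    · refine inj _ fun w hw => eq_zero_of_vecMul_eq_zero hB
        (coefV_zero_right f lam k p) (fun w h0 hw i => ?_) (coefV_vecMul_matOne f lam k p)
        (fun i hi => (hk.eig_eq_zero hlam' hi).2) hl hv hw
      have h1 := hw i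
      rw [vecMul_matOne_succ, h0, zero_mul, zero_add] at h1
      exact (mul_eq_zero.mp h1).resolve_left (hlam' _ i.2)
    · refine inj _ fun w hw => eq_zero_of_vecMul_eq_zero hA
        (coefU_zero_right f lam k p) (fun w h0 hw i => ?_) (coefU_vecMul_matF f lam k p)
        (fun i hi => (hk.eig_eq_zero hlam' hi).1) hl hu hw
      have h1 := hw i
      rw [vecMul_matF_succ, h0, zero_add] at h1
      exact (mul_eq_zero.mp h1).resolve_left (hlam' _ i.2)

/-! ### The scalar quasideterminants -/

lemma quasidetScalar_eq_of_vecMul {ι : Type*} [Fintype ι] [DecidableEq ι] {row x col : ι → ℂ}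
    {A : Matrix ι ι ℂ} (hA : IsUnit A) (hx : x ᵥ* A = -row) :
    quasidetScalar row 0 A col = x ⬝ᵥ col := by
  have hrow : row = -(x ᵥ* A) := by rw [hx, neg_neg]
  rw [quasidetScalar, hrow, neg_dotProduct, zero_sub, neg_neg, ← Matrix.dotProduct_mulVec,
    Matrix.mulVec_mulVec, Matrix.mul_nonsing_inv _ ((Matrix.isUnit_iff_isUnit_det A).mp hA),
    Matrix.one_mulVec]

lemma dotProduct_e1 (x : ℕ → ℂ) (hx : k = 0 → x 1 = 0) :
    (fun j : Fin k => x (j + 1)) ⬝ᵥ e1 k = x 1 := by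
  rcases k with _ | k
  · simp [hx]
  · simp [dotProduct, e1]

/-- Vanishing of `eigU` at the first `k` seeds says that the coefficients of positive degree solve
`x ᵥ* matOne = -(1, …, 1)`. -/
lemma Nondegenerate.quasiOne_eq (hlam : ∀ i < k, lam i ≠ 0) (h : Nondegenerate f lam k p) :
    quasiOne f lam k p = coefU f lam k p 1 := by
  rw [quasiOne, quasidetScalar_eq_of_vecMul (x := fun j : Fin k => coefU f lam k p (j + 1))
    (h.isUnit hlam).1, dotProduct_e1 (coefU f lam k p) (by rintro rfl; rfl)]
  funext i
  rw [coefU_vecMul_matOne, (h.eig_eq_zero hlam i.2).1]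
  simp

lemma Nondegenerate.quasiF_eq (hlam : ∀ i < k, lam i ≠ 0) (h : Nondegenerate f lam k p) :
    quasiF f lam k p = coefV f lam k p 1 := by
  rw [quasiF, quasidetScalar_eq_of_vecMul (x := fun j : Fin k => coefV f lam k p (j + 1))
    (h.isUnit hlam).2, dotProduct_e1 (coefV f lam k p) (by rintro rfl; rfl)]
  funext i
  rw [coefV_vecMul_matF, (h.eig_eq_zero hlam i.2).2]
  simp

end Algebra

/-! ### The iterated Darboux transformation of the potentials -/

/-- The square root of `-1` governing the `k`-th transformed system. -/
def signI (k : ℕ) : ℂ := (-1) ^ k * Complex.I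

lemma signI_succ (k : ℕ) : signI (k + 1) = -signI k := by rw [signI, signI, pow_succ]; ring

lemma signI_sq (k : ℕ) : signI k ^ 2 = -1 := by
  rw [signI, mul_pow, ← pow_mul, mul_comm k 2, pow_mul]; simp

/-- The `k`-fold Darboux transform of `(q, r)`, without the factors `sigma`. -/
def potPair (f : ℕ → ℝ × ℝ → ℂ) (lam : ℕ → ℂ) (q r : ℝ × ℝ → ℂ) :
    ℕ → (ℝ × ℝ → ℂ) × (ℝ × ℝ → ℂ)
  | 0 => (q, r)
  | k + 1 =>
      (darbouxR (-signI k) (potPair f lam q r k).2 (lam k)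
          (fun p => eigU f lam k k p / eigV f lam k k p),
        darbouxR (signI k) (potPair f lam q r k).1 (lam k)
          (fun p => eigV f lam k k p / eigU f lam k k p))

section Chain

variable {m : WithTop ℕ∞} {D : Set (ℝ × ℝ)} {q r : ℝ × ℝ → ℂ} {f : ℕ → ℝ × ℝ → ℂ} {lam : ℕ → ℂ}
  {n k : ℕ}

lemma IsSolution.isSol (h : IsSolution m D q r) (hD : IsOpen D) (hm : 2 ≤ m) :
    IsSol m D Complex.I q r := by
  have hm0 : m ≠ 0 := by rintro rfl; simp at hm
  refine ⟨h.contDiff_q, h.contDiff_r, fun p hp => ?_, fun p hp => ?_⟩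
  all_goals
    have hq := hasDerivAt_dx hD h.contDiff_q hm0 hp
    have hr := hasDerivAt_dx hD h.contDiff_r hm0 hp
  · have h1 := h.eq_q p hp
    rw [dx_eq_of_hasDerivAt (g := fun p' => q p' ^ 2 * r p')
      ((hq.fun_pow 2).fun_mul hr)] at h1
    push_cast at h1
    linear_combination -Complex.I * h1 + (dt q p - 2 * q p * r p * dx q p
      - q p ^ 2 * dx r p) * Complex.I_sq
  · have h1 := h.eq_r p hp
    rw [dx_eq_of_hasDerivAt (g := fun p' => r p' ^ 2 * q p')
      ((hr.fun_pow 2).fun_mul hq)] at h1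
    push_cast at h1
    linear_combination -Complex.I * h1 + (dt r p - 2 * q p * r p * dx r p
      - r p ^ 2 * dx q p) * Complex.I_sq

lemma IsSol.isSolution (h : IsSol m D Complex.I q r) (hD : IsOpen D) (hm : 2 ≤ m) :
    IsSolution m D q r := by
  have hm0 : m ≠ 0 := by rintro rfl; simp at hm
  refine ⟨h.contDiff_q, h.contDiff_r, fun p hp => ?_, fun p hp => ?_⟩
  all_goals
    have hq := hasDerivAt_dx hD h.contDiff_q hm0 hp
    have hr := hasDerivAt_dx hD h.contDiff_r hm0 hp
  · rw [dx_eq_of_hasDerivAt (g := fun p' => q p' ^ 2 * r p')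
      ((hq.fun_pow 2).fun_mul hr), h.eq_q p hp]
    push_cast
    linear_combination dx (dx q) p * Complex.I_sq
  · rw [dx_eq_of_hasDerivAt (g := fun p' => r p' ^ 2 * q p')
      ((hr.fun_pow 2).fun_mul hq), h.eq_r p hp]
    push_cast
    linear_combination -dx (dx r) p * Complex.I_sq

lemma IsSolution.congr {q' r' : ℝ × ℝ → ℂ} (h : IsSolution m D q r) (hD : IsOpen D)
    (hq : ∀ p ∈ D, q' p = q p) (hr : ∀ p ∈ D, r' p = r p) : IsSolution m D q' r' where
  contDiff_q := h.contDiff_q.congr hq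
  contDiff_r := h.contDiff_r.congr hr
  eq_q p hp := by
    rw [dt_congr hD hq hp, dx_congr hD (fun p hp => dx_congr hD hq hp) hp,
      dx_congr hD (g := fun p' => q' p' ^ 2 * r' p') (h := fun p' => q p' ^ 2 * r p')
        (fun p hp => by rw [hq p hp, hr p hp]) hp]
    exact h.eq_q p hp
  eq_r p hp := by
    rw [dt_congr hD hr hp, dx_congr hD (fun p hp => dx_congr hD hr hp) hp,
      dx_congr hD (g := fun p' => r' p' ^ 2 * q' p') (h := fun p' => r p' ^ 2 * q p')
        (fun p hp => by rw [hq p hp, hr p hp]) hp]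
    exact h.eq_r p hp

lemma dx_const (a : ℂ) (p : ℝ × ℝ) : dx (fun _ => a) p = 0 := deriv_const _ _

lemma dt_const (a : ℂ) (p : ℝ × ℝ) : dt (fun _ => a) p = 0 := deriv_const _ _

/-- A Riccati solution `F` gives the vector `(1, F)`. -/
lemma IsRiccatiSolution.isLax {l : ℂ} {F : ℝ × ℝ → ℂ} (h : IsRiccatiSolution m D q r l F) :
    IsLax m D Complex.I q r l (fun p => Complex.I * l ^ 2 - l * q p * F p)
      (fun p => 2 * Complex.I * l ^ 4 - 2 * l ^ 3 * q p * F p + Complex.I * q p * r p * l ^ 2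
        - l * (Complex.I * dx q p + r p * q p ^ 2) * F p) (fun _ => 1) F where
  contDiff_u := contDiffOn_const
  contDiff_v := h.contDiff
  -- `κ` and `τ` are the values forced by the first-component equations for the constant `u = 1`.
  x_u p _ := by rw [dx_const]; ring
  x_v p hp := by linear_combination h.eq_x p hp
  t_u p _ := by rw [dt_const]; ring
  t_v p hp := by linear_combination h.eq_t p hp

/-- The induction carries the Lax equations for all `i < n`, since each vector becomes the seed of a
later step. -/
lemma potPair_spec (hD : IsOpen D) (hm : 2 ≤ m) (hqr : IsSolution m D q r)
    (hlam : ∀ i < n, lam i ≠ 0) (hf : ∀ i < n, IsRiccatiSolution m D q r (lam i) (f i))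
    (hk : k ≤ n) (hnd : ∀ p ∈ D, Nondegenerate f lam k p) :
    IsSol m D (signI k) (potPair f lam q r k).1 (potPair f lam q r k).2 ∧
      ∀ i < n, ∃ κ τ, IsLax m D (signI k) (potPair f lam q r k).1 (potPair f lam q r k).2
        (lam i) κ τ (eigU f lam k i) (eigV f lam k i) := by
  have hm0 : m ≠ 0 := by rintro rfl; simp at hm
  induction k with
  | zero =>
    have h0 : signI 0 = Complex.I := by simp [signI]
    rw [h0]
    exact ⟨hqr.isSol hD hm, fun i hi => ⟨_, _, (hf i hi).isLax⟩⟩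
  | succ k ih =>
    obtain ⟨hs, hl⟩ := ih (by omega) fun p hp => (hnd p hp).mono (Nat.le_succ k)
    obtain ⟨κ, τ, hk'⟩ := hl k (by omega)
    have hu : ∀ p ∈ D, eigU f lam k k p ≠ 0 := fun p hp => (hnd p hp k (Nat.lt_succ_self k)).1
    have hv : ∀ p ∈ D, eigV f lam k k p ≠ 0 := fun p hp => (hnd p hp k (Nat.lt_succ_self k)).2
    have hF := hk'.isRic hD hm0 hu
    have hW := hk'.swap.isRic hD hm0 hv
    have hFW : ∀ p ∈ D, eigV f lam k k p / eigU f lam k k p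
        * (eigU f lam k k p / eigV f lam k k p) = 1 := fun p hp => by
      have := hu p hp
      have := hv p hp
      field_simp
    rw [signI_succ]
    refine ⟨hs.darboux hD hm (signI_sq k) hF hW hFW, fun i hi => ?_⟩
    obtain ⟨κ, τ, h⟩ := hl i hi
    exact ⟨κ, τ, h.darboux hD hm (hlam k (by omega)) (signI_sq k) hs hF hW hFW⟩

/-- One step of the transformation of the potentials, in terms of derivatives. -/
lemma potPair_succ (hD : IsOpen D) (hm : 2 ≤ m) (hqr : IsSolution m D q r)
    (hlam : ∀ i < n, lam i ≠ 0) (hf : ∀ i < n, IsRiccatiSolution m D q r (lam i) (f i))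
    (hk : k < n) (hnd : ∀ p ∈ D, Nondegenerate f lam (k + 1) p) :
    ContDiffOn ℝ m (fun p => (lam k)⁻¹ * (eigU f lam k k p / eigV f lam k k p)) D ∧
    ContDiffOn ℝ m (fun p => (lam k)⁻¹ * (eigV f lam k k p / eigU f lam k k p)) D ∧
    ∀ p ∈ D, (potPair f lam q r (k + 1)).1 p = (potPair f lam q r k).1 p
        - dx (fun p => (lam k)⁻¹ * (eigU f lam k k p / eigV f lam k k p)) p ∧
      (potPair f lam q r (k + 1)).2 p = (potPair f lam q r k).2 p
        - dx (fun p => (lam k)⁻¹ * (eigV f lam k k p / eigU f lam k k p)) p := by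
  have hm0 : m ≠ 0 := by rintro rfl; simp at hm
  obtain ⟨-, hl⟩ := potPair_spec hD hm hqr hlam hf hk.le
    fun p hp => (hnd p hp).mono (Nat.le_succ k)
  obtain ⟨κ, τ, hk'⟩ := hl k hk
  have hF := hk'.isRic hD hm0 fun p hp => (hnd p hp k (Nat.lt_succ_self k)).1
  have hW := hk'.swap.isRic hD hm0 fun p hp => (hnd p hp k (Nat.lt_succ_self k)).2
  exact ⟨contDiffOn_const.mul hW.contDiff, contDiffOn_const.mul hF.contDiff,
    fun p hp => ⟨hW.darbouxR_eq (hlam k hk) hp, hF.darbouxR_eq (hlam k hk) hp⟩⟩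

/-- The transformed potentials differ from the original ones by the derivatives of the linear
coefficients of the Darboux matrix. -/
lemma potPair_eq (hD : IsOpen D) (hm : 2 ≤ m) (hqr : IsSolution m D q r)
    (hlam : ∀ i < n, lam i ≠ 0) (hf : ∀ i < n, IsRiccatiSolution m D q r (lam i) (f i))
    (hk : k ≤ n) (hnd : ∀ p ∈ D, Nondegenerate f lam k p) :
    ContDiffOn ℝ m (fun p => coefU f lam k p 1) D ∧ ContDiffOn ℝ m (fun p => coefV f lam k p 1) D ∧
      ∀ p ∈ D, (potPair f lam q r k).1 p = q p + dx (fun p => coefU f lam k p 1) p ∧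
        (potPair f lam q r k).2 p = r p + dx (fun p => coefV f lam k p 1) p := by
  have hm0 : m ≠ 0 := by rintro rfl; simp at hm
  induction k with
  | zero =>
    have hU : (fun p => coefU f lam 0 p 1) = fun _ => 0 := rfl
    have hV : (fun p => coefV f lam 0 p 1) = fun _ => 0 := rfl
    rw [hU, hV]
    refine ⟨contDiffOn_const, contDiffOn_const, fun p _ => ?_⟩
    rw [dx_const, add_zero, add_zero]
    exact ⟨rfl, rfl⟩
  | succ k ih =>
    obtain ⟨hU, hV, hpot⟩ := ih (by omega) fun p hp => (hnd p hp).mono (Nat.le_succ k)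
    obtain ⟨hW, hF, hstep⟩ := potPair_succ hD hm hqr hlam hf (by omega : k < n) hnd
    have eU : (fun p => coefU f lam (k + 1) p 1) = fun p => coefU f lam k p 1
        - (lam k)⁻¹ * (eigU f lam k k p / eigV f lam k k p) := by
      funext p; rw [coefU_succ, coefV_zero_right, mul_one]
    have eV : (fun p => coefV f lam (k + 1) p 1) = fun p => coefV f lam k p 1
        - (lam k)⁻¹ * (eigV f lam k k p / eigU f lam k k p) := by
      funext p; rw [coefV_succ, coefU_zero_right, mul_one]
    rw [eU, eV]
    refine ⟨hU.sub hW, hV.sub hF, fun p hp => ⟨?_, ?_⟩⟩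
    · have h1 := dx_eq_of_hasDerivAt (g := fun p => coefU f lam k p 1
        - (lam k)⁻¹ * (eigU f lam k k p / eigV f lam k k p))
        ((hasDerivAt_dx hD hU hm0 hp).fun_sub (hasDerivAt_dx hD hW hm0 hp))
      rw [(hstep p hp).1, (hpot p hp).1, h1]
      ring
    · have h1 := dx_eq_of_hasDerivAt (g := fun p => coefV f lam k p 1
        - (lam k)⁻¹ * (eigV f lam k k p / eigU f lam k k p))
        ((hasDerivAt_dx hD hV hm0 hp).fun_sub (hasDerivAt_dx hD hF hm0 hp))
      rw [(hstep p hp).2, (hpot p hp).2, h1]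
      ring

lemma qNew_eq (hD : IsOpen D) (hlam : ∀ i < n, lam i ≠ 0)
    (hnd : ∀ p ∈ D, Nondegenerate f lam n p)
    (hpot : ∀ p ∈ D, (potPair f lam q r n).1 p = q p + dx (fun p => coefU f lam n p 1) p ∧
        (potPair f lam q r n).2 p = r p + dx (fun p => coefV f lam n p 1) p)
    {p : ℝ × ℝ} (hp : p ∈ D) :
    qNew q r f lam n p = (if Odd n then (potPair f lam q r n).2 p else (potPair f lam q r n).1 p) ∧
    rNew q r f lam n p
      = if Odd n then (potPair f lam q r n).1 p else (potPair f lam q r n).2 p := by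
  rw [qNew, rNew, (hpot p hp).1, (hpot p hp).2,
    dx_congr hD (fun p hp => (hnd p hp).quasiOne_eq hlam) hp,
    dx_congr hD (fun p hp => (hnd p hp).quasiF_eq hlam) hp]
  exact ⟨rfl, rfl⟩

lemma isSolution_new (hD : IsOpen D) (hm : 2 ≤ m) (hqr : IsSolution m D q r)
    (hlam : ∀ i < n, lam i ≠ 0) (hf : ∀ i < n, IsRiccatiSolution m D q r (lam i) (f i))
    (hnd : ∀ p ∈ D, Nondegenerate f lam n p) :
    IsSolution m D (qNew q r f lam n) (rNew q r f lam n) := by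
  obtain ⟨-, -, hpot⟩ := potPair_eq hD hm hqr hlam hf le_rfl hnd
  obtain ⟨hs, -⟩ := potPair_spec hD hm hqr hlam hf le_rfl hnd
  have hnew := fun p hp => qNew_eq hD hlam hnd hpot (p := p) hp
  by_cases hn : Odd n
  · simp only [hn, if_true] at hnew
    -- After an odd number of steps the sign is `-Complex.I`; exchanging the potentials restores
    -- `Complex.I`.
    have h1 := hs.swap
    rw [signI, hn.neg_one_pow, neg_one_mul, neg_neg] at h1
    exact (h1.isSolution hD hm).congr hD (fun p hp => (hnew p hp).1) (fun p hp => (hnew p hp).2)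
  · simp only [hn, if_false] at hnew
    rw [signI, (Nat.not_odd_iff_even.mp hn).neg_one_pow, one_mul] at hs
    exact (hs.isSolution hD hm).congr hD (fun p hp => (hnew p hp).1) (fun p hp => (hnew p hp).2)

end Chain

/-! ### Matrix eigenfunctions -/

section Matrices

variable {D : Set (ℝ × ℝ)} {q r : ℝ × ℝ → ℂ} {f : ℕ → ℝ × ℝ → ℂ} {lam : ℕ → ℂ}
  {θ : ℕ → ℝ × ℝ → Matrix (Fin 2) (Fin 2) ℂ} {φ φ' : ℕ → ℝ × ℝ → ℂ} {n k : ℕ} {p : ℝ × ℝ}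

lemma sigma_mul_sigma : sigma * sigma = 1 := by
  ext a b; fin_cases a <;> fin_cases b <;> simp [sigma]

lemma sigma_pow_mul_sigma_pow (k : ℕ) : sigma ^ k * sigma ^ k = 1 := by
  rw [← pow_add, ← two_mul, pow_mul, sq, sigma_mul_sigma, one_pow]

lemma sigma_pow_conj (k : ℕ) (a b : ℂ) : sigma ^ k * !![0, a; b, 0] * sigma ^ k
    = if Odd k then !![0, b; a, 0] else !![0, a; b, 0] := by
  split_ifs with h
  · have : sigma ^ k = sigma := by
      obtain ⟨j, rfl⟩ := h
      rw [pow_succ, pow_mul, sq, sigma_mul_sigma, one_pow, one_mul]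
    rw [this]
    ext a b; fin_cases a <;> fin_cases b <;> simp [sigma]
  · have : sigma ^ k = 1 := by
      obtain ⟨j, rfl⟩ := Nat.not_odd_iff_even.mp h
      rw [← two_mul, pow_mul, sq, sigma_mul_sigma, one_pow]
    rw [this, one_mul, mul_one]

lemma Lam_pow (l : ℂ) (j : ℕ) : Lam l ^ j = !![l ^ j, 0; 0, (-l) ^ j] := by
  induction j with
  | zero => ext a b; fin_cases a <;> fin_cases b <;> simp
  | succ j ih => rw [pow_succ, ih, Lam]; ext a b; fin_cases a <;> fin_cases b <;> simp [pow_succ]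

lemma Lam_inv {l : ℂ} (hl : l ≠ 0) : (Lam l)⁻¹ = Lam l⁻¹ := by
  refine Matrix.inv_eq_left_inv ?_
  ext a b; fin_cases a <;> fin_cases b <;> simp [Lam, hl]

/-- The matrix with columns `φ (u, v)` and `φ' (u, -v)`. -/
def eigMat (u v φ φ' : ℂ) : Matrix (Fin 2) (Fin 2) ℂ := !![u * φ, u * φ'; v * φ, -(v * φ')]

/-- The determinant of `eigMat` is `-2 u v φ φ'`. -/
lemma eigMat_ne_zero {u v φ φ' : ℂ} (h : IsUnit (sigma ^ k * eigMat u v φ φ')) :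
    u ≠ 0 ∧ v ≠ 0 ∧ φ ≠ 0 ∧ φ' ≠ 0 := by
  have h1 : (eigMat u v φ φ').det ≠ 0 := by
    rw [Matrix.isUnit_iff_isUnit_det, Matrix.det_mul] at h
    exact (isUnit_of_mul_isUnit_right h).ne_zero
  rw [eigMat, Matrix.det_fin_two_of] at h1
  refine ⟨?_, ?_, ?_, ?_⟩ <;> rintro rfl <;> simp at h1

/-- The antidiagonal matrix has eigenvectors `(u, v)` and `(u, -v)` with eigenvalues `l⁻¹` and
`-l⁻¹`, whatever the scalings `φ`, `φ'`. -/
lemma eigMat_mul_Lam_inv {u v φ φ' l : ℂ} (hl : l ≠ 0)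
    (h : IsUnit (sigma ^ k * eigMat u v φ φ')) :
    sigma ^ k * eigMat u v φ φ' * (Lam l)⁻¹ * (sigma ^ k * eigMat u v φ φ')⁻¹
      = sigma ^ k * !![0, l⁻¹ * (u / v); l⁻¹ * (v / u), 0] * sigma ^ k := by
  obtain ⟨hu, hv, -, -⟩ := eigMat_ne_zero h
  have h1 : eigMat u v φ φ' * (Lam l)⁻¹
      = !![0, l⁻¹ * (u / v); l⁻¹ * (v / u), 0] * eigMat u v φ φ' := by
    rw [Lam_inv hl, eigMat, Lam]
    ext a b
    fin_cases a <;> fin_cases b <;> simp <;> field_simp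
  rw [mul_assoc (sigma ^ k) (eigMat u v φ φ'), h1]
  have h2 : sigma ^ k * (!![0, l⁻¹ * (u / v); l⁻¹ * (v / u), 0] * eigMat u v φ φ')
      = sigma ^ k * !![0, l⁻¹ * (u / v); l⁻¹ * (v / u), 0] * sigma ^ k
        * (sigma ^ k * eigMat u v φ φ') := by
    rw [mul_assoc (_ * _), ← mul_assoc (sigma ^ k) (sigma ^ k), sigma_pow_mul_sigma_pow, one_mul,
      mul_assoc]
  rw [h2, mul_assoc, Matrix.mul_nonsing_inv _ ((Matrix.isUnit_iff_isUnit_det _).mp h), mul_one]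

lemma thetaIter_eq (hlam : ∀ i < n, lam i ≠ 0)
    (hθ : ∀ i < n, θ i = thetaMat (f i) (φ i) (φ' i))
    (hunit : ∀ k < n, IsUnit (thetaIter θ lam k k p)) (hk : k ≤ n) :
    ∀ i < n, thetaIter θ lam k i p
      = sigma ^ k * eigMat (eigU f lam k i p) (eigV f lam k i p) (φ i p) (φ' i p) := by
  induction k with
  | zero =>
    intro i hi
    rw [thetaIter, hθ i hi, thetaMat, eigMat, eigU_zero, eigV_zero, pow_zero, one_mul, one_mul,
      one_mul]
  | succ k ih =>
    have ih := ih (by omega)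
    intro i hi
    have hu := hunit k (by omega)
    have hl := hlam k (by omega)
    rw [ih k (by omega)] at hu
    rw [thetaIter, ih k (by omega), ih i hi, eigMat_mul_Lam_inv hl hu,
      pow_succ', mul_assoc sigma]
    congr 1
    rw [mul_assoc (sigma ^ k * _), mul_assoc (sigma ^ k) _ (Lam _), ← mul_assoc (sigma ^ k) (sigma ^ k),
      sigma_pow_mul_sigma_pow, one_mul, mul_assoc, ← mul_sub]
    congr 1
    rw [eigU_succ, eigV_succ]
    ext a b
    fin_cases a <;> fin_cases b <;> simp [eigMat, Lam] <;> ring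

lemma nondegenerate_of_thetaIter (hlam : ∀ i < n, lam i ≠ 0)
    (hθ : ∀ i < n, θ i = thetaMat (f i) (φ i) (φ' i))
    (hunit : ∀ k < n, IsUnit (thetaIter θ lam k k p)) :
    Nondegenerate f lam n p ∧ ∀ i < n, φ i p ≠ 0 ∧ φ' i p ≠ 0 := by
  have h1 : ∀ i < n, eigU f lam i i p ≠ 0 ∧ eigV f lam i i p ≠ 0 ∧ φ i p ≠ 0 ∧ φ' i p ≠ 0 := by
    intro i hi
    have h2 := hunit i hi
    rw [thetaIter_eq hlam hθ hunit hi.le i hi] at h2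
    exact eigMat_ne_zero h2
  exact ⟨fun i hi => ⟨(h1 i hi).1, (h1 i hi).2.1⟩, fun i hi => (h1 i hi).2.2⟩

lemma dxMat_congr {A B : ℝ × ℝ → Matrix (Fin 2) (Fin 2) ℂ} (hD : IsOpen D)
    (h : ∀ p ∈ D, A p = B p) (hp : p ∈ D) : dxMat A p = dxMat B p := by
  ext a b
  exact dx_congr (g := fun p => A p a b) (h := fun p => B p a b) hD
    (fun p hp => congrFun (congrFun (h p hp) a) b) hp

lemma dxMat_offDiag (a b : ℝ × ℝ → ℂ) (p : ℝ × ℝ) :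
    dxMat (fun p => !![0, a p; b p, 0]) p = !![0, dx a p; dx b p, 0] := by
  ext i j
  fin_cases i <;> fin_cases j
  · exact dx_const 0 p
  · rfl
  · rfl
  · exact dx_const 0 p

lemma dxMat_sigma_pow_conj (k : ℕ) (a b : ℝ × ℝ → ℂ) (p : ℝ × ℝ) :
    dxMat (fun p => sigma ^ k * !![0, a p; b p, 0] * sigma ^ k) p
      = sigma ^ k * !![0, dx a p; dx b p, 0] * sigma ^ k := by
  simp only [sigma_pow_conj]
  split_ifs <;> exact dxMat_offDiag _ _ _

lemma RIter_eq (hD : IsOpen D) (hlam : ∀ i < n, lam i ≠ 0)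
    (hθ : ∀ i < n, θ i = thetaMat (f i) (φ i) (φ' i))
    (hunit : ∀ k < n, ∀ p ∈ D, IsUnit (thetaIter θ lam k k p)) (hk : k ≤ n)
    (hpot : ∀ k < n, ∀ p ∈ D,
      (potPair f lam q r (k + 1)).1 p = (potPair f lam q r k).1 p
        - dx (fun p => (lam k)⁻¹ * (eigU f lam k k p / eigV f lam k k p)) p ∧
      (potPair f lam q r (k + 1)).2 p = (potPair f lam q r k).2 p
        - dx (fun p => (lam k)⁻¹ * (eigV f lam k k p / eigU f lam k k p)) p) :
    ∀ p ∈ D, RIter (R q r) θ lam k p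
      = sigma ^ k * !![0, (potPair f lam q r k).1 p; (potPair f lam q r k).2 p, 0] * sigma ^ k := by
  induction k with
  | zero => intro p _; simp [RIter, R, potPair]
  | succ k ih =>
    intro p hp
    have hS : ∀ p ∈ D, thetaIter θ lam k k p * (Lam (lam k))⁻¹ * (thetaIter θ lam k k p)⁻¹
        = sigma ^ k * !![0, (lam k)⁻¹ * (eigU f lam k k p / eigV f lam k k p);
            (lam k)⁻¹ * (eigV f lam k k p / eigU f lam k k p), 0] * sigma ^ k := by
      intro p hp
      have hu := hunit k (by omega) p hp
      have he := thetaIter_eq hlam hθ (fun k hk => hunit k hk p hp) (by omega : k ≤ n) k (by omega)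
      rw [he] at hu ⊢
      exact eigMat_mul_Lam_inv (hlam k (by omega)) hu
    rw [RIter, ih (by omega) p hp, dxMat_congr hD hS hp, dxMat_sigma_pow_conj,
      (hpot k (by omega) p hp).1, (hpot k (by omega) p hp).2, ← sub_mul, ← mul_sub]
    have hR : ∀ X, sigma ^ (k + 1) * X * sigma ^ (k + 1)
        = sigma * (sigma ^ k * X * sigma ^ k) * sigma := by
      intro X
      nth_rewrite 1 [pow_succ']
      rw [pow_succ]
      simp only [mul_assoc]
    rw [hR]
    congr 4
    ext a b
    fin_cases a <;> fin_cases b <;> simp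

/-- A left null vector gives one equation at `λ` and one at `-λ` for each `i`. Their sum and
difference separate the parities, leaving null vectors of `matOne` and `matF`. -/
lemma isUnit_ThetaHat (hlam : ∀ i < n, lam i ≠ 0)
    (hθ : ∀ i < n, θ i p = eigMat 1 (f i p) (φ i p) (φ' i p))
    (hnd : Nondegenerate f lam n p) (hφ : ∀ i < n, φ i p ≠ 0 ∧ φ' i p ≠ 0) :
    IsUnit (ThetaHat θ lam n p) := by
  obtain ⟨hA, hB⟩ := hnd.isUnit hlam
  have inj : ∀ w, w ᵥ* ThetaHat θ lam n p = 0 → w = 0 := by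
    intro w hw
    have hcol : ∀ i : Fin n, ∀ b : Fin 2, ∑ j : Fin n, (w (j, 0) * (θ i p 0 b)
        + w (j, 1) * (θ i p 1 b)) * (if b = 0 then lam i else -lam i) ^ ((j : ℕ) + 1) = 0 := by
      intro i b
      have h1 := congrFun hw (i, b)
      rw [Matrix.vecMul, dotProduct, Fintype.sum_prod_type] at h1
      refine Eq.trans (Finset.sum_congr rfl fun j _ => ?_) h1
      simp only [ThetaHat, Matrix.of_apply, Lam_pow, Fin.sum_univ_two]
      fin_cases b <;> simp [Matrix.mul_apply, Fin.sum_univ_two] <;> ring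
    have h0 : ∀ i : Fin n, ∑ j : Fin n, (w (j, 0) + w (j, 1) * f i p) * lam i ^ ((j : ℕ) + 1)
        = 0 := by
      intro i
      refine (mul_eq_zero.mp (?_ : φ i p * _ = 0)).resolve_left (hφ i i.2).1
      refine Eq.trans ?_ (hcol i 0)
      rw [Finset.mul_sum]
      refine Finset.sum_congr rfl fun j _ => ?_
      rw [hθ i i.2]
      simp [eigMat]; ring
    have h1 : ∀ i : Fin n, ∑ j : Fin n, (w (j, 0) - w (j, 1) * f i p)
        * (-lam i) ^ ((j : ℕ) + 1) = 0 := by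
      intro i
      refine (mul_eq_zero.mp (?_ : φ' i p * _ = 0)).resolve_left (hφ i i.2).2
      refine Eq.trans ?_ (hcol i 1)
      rw [Finset.mul_sum]
      refine Finset.sum_congr rfl fun j _ => ?_
      rw [hθ i i.2]
      simp [eigMat]; ring
    have hwA : (fun j : Fin n => w (j, if Even (j : ℕ) then 1 else 0)) = 0 := by
      refine Matrix.vecMul_injective_iff_isUnit.mpr hA ?_
      simp only [Matrix.zero_vecMul]
      funext i
      have h2 := congrArg₂ (· + ·) (h0 i) (h1 i)
      simp only [← Finset.sum_add_distrib, add_zero] at h2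
      refine (mul_eq_zero.mp (?_ : (2 : ℂ) * _ = 0)).resolve_left two_ne_zero
      refine Eq.trans ?_ h2
      rw [Matrix.vecMul, dotProduct, Finset.mul_sum]
      refine Finset.sum_congr rfl fun j _ => ?_
      by_cases hj : Even (j : ℕ)
      · simp only [matOne, Matrix.of_apply, hj, if_true, (hj.add_one).neg_pow]
        ring
      · simp only [matOne, Matrix.of_apply, hj, if_false,
          ((Nat.not_even_iff_odd.mp hj).add_one).neg_pow]
        ring
    have hwB : (fun j : Fin n => w (j, if Even (j : ℕ) then 0 else 1)) = 0 := by
      refine Matrix.vecMul_injective_iff_isUnit.mpr hB ?_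
      simp only [Matrix.zero_vecMul]
      funext i
      have h2 := congrArg₂ (· - ·) (h0 i) (h1 i)
      simp only [← Finset.sum_sub_distrib, sub_zero] at h2
      refine (mul_eq_zero.mp (?_ : (2 : ℂ) * _ = 0)).resolve_left two_ne_zero
      refine Eq.trans ?_ h2
      rw [Matrix.vecMul, dotProduct, Finset.mul_sum]
      refine Finset.sum_congr rfl fun j _ => ?_
      by_cases hj : Even (j : ℕ)
      · simp only [matF, Matrix.of_apply, hj, if_true, (hj.add_one).neg_pow]
        ring
      · simp only [matF, Matrix.of_apply, hj, if_false,
          ((Nat.not_even_iff_odd.mp hj).add_one).neg_pow]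
        ring
    funext ⟨j, a⟩
    have hj0 := congrFun hwA j
    have hj1 := congrFun hwB j
    by_cases hj : Even (j : ℕ) <;> simp only [hj, if_true, if_false] at hj0 hj1 <;>
      fin_cases a <;> assumption
  exact Matrix.vecMul_injective_iff_isUnit.mp fun x y hxy =>
    sub_eq_zero.mp (inj _ (by rw [Matrix.sub_vecMul]; exact sub_eq_zero.mpr hxy))

/-- The coefficients of positive degree of the Darboux matrix, as a block row. -/
def coefMat (f : ℕ → ℝ × ℝ → ℂ) (lam : ℕ → ℂ) (n : ℕ) (p : ℝ × ℝ) :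
    Matrix (Fin 2) (Fin n × Fin 2) ℂ :=
  Matrix.of fun a jb =>
    if Even (jb.1 : ℕ) ↔ a = jb.2 then 0
    else if a = 0 then coefU f lam n p (jb.1 + 1) else coefV f lam n p (jb.1 + 1)

/-- The Darboux matrix kills both columns of each `θ i`: by the parity pattern of its coefficients,
vanishing on `(1, f)` at `λ` implies vanishing on `(1, -f)` at `-λ`. -/
lemma coefMat_mul_ThetaHat (hlam : ∀ i < n, lam i ≠ 0)
    (hθ : ∀ i < n, θ i p = eigMat 1 (f i p) (φ i p) (φ' i p))
    (hnd : Nondegenerate f lam n p) :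
    coefMat f lam n p * ThetaHat θ lam n p = -Theta θ n p := by
  ext a ⟨i, b⟩
  have hU := coefU_vecMul_matOne f lam n p i
  have hV := coefV_vecMul_matF f lam n p i
  rw [(hnd.eig_eq_zero hlam i.2).1, Matrix.vecMul, dotProduct] at hU
  rw [(hnd.eig_eq_zero hlam i.2).2, Matrix.vecMul, dotProduct] at hV
  rw [Matrix.mul_apply, Fintype.sum_prod_type]
  simp only [Fin.sum_univ_two, Matrix.neg_apply, Theta, Matrix.of_apply]
  rw [hθ i i.2]
  have hsum : ∀ s : ℂ, ∀ g h : Fin n → ℂ, (∀ j, h j = s * g j) → ∑ j, h j = s * ∑ j, g j := by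
    intro s g h hgh
    rw [Finset.mul_sum]
    exact Finset.sum_congr rfl fun j _ => hgh j
  fin_cases a <;> fin_cases b
  · refine (hsum (φ i p) _ _ fun j => ?_).trans ((congrArg _ hU).trans ?_)
    · by_cases hj : Even (j : ℕ) <;>
        simp [coefMat, ThetaHat, matOne, hθ i i.2, eigMat, Lam_pow, hj] <;> ring
    · simp [eigMat]
  · refine (hsum (φ' i p) _ _ fun j => ?_).trans ((congrArg _ hU).trans ?_)
    · by_cases hj : Even (j : ℕ)
      · simp [coefMat, ThetaHat, matOne, hθ i i.2, eigMat, Lam_pow, hj, hj.add_one.neg_pow]; ring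
      · simp [coefMat, ThetaHat, matOne, hθ i i.2, eigMat, Lam_pow, hj,
          (Nat.not_even_iff_odd.mp hj).add_one.neg_pow]; ring
    · simp [eigMat]
  · refine (hsum (φ i p) _ _ fun j => ?_).trans ((congrArg _ hV).trans ?_)
    · by_cases hj : Even (j : ℕ) <;>
        simp [coefMat, ThetaHat, matF, hθ i i.2, eigMat, Lam_pow, hj] <;> ring
    · simp [eigMat]; ring
  · refine (hsum (-φ' i p) _ _ fun j => ?_).trans ((congrArg _ hV).trans ?_)
    · by_cases hj : Even (j : ℕ)
      · simp [coefMat, ThetaHat, matF, hθ i i.2, eigMat, Lam_pow, hj, hj.add_one.neg_pow]; ring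
      · simp [coefMat, ThetaHat, matF, hθ i i.2, eigMat, Lam_pow, hj,
          (Nat.not_even_iff_odd.mp hj).add_one.neg_pow]; ring
    · simp [eigMat]; ring

lemma coefMat_mul_blockE (f : ℕ → ℝ × ℝ → ℂ) (lam : ℕ → ℂ) (n : ℕ) (p : ℝ × ℝ) :
    coefMat f lam n p * blockE n = !![0, coefU f lam n p 1; coefV f lam n p 1, 0] := by
  rcases n with _ | n
  · have hU : coefU f lam 0 p 1 = 0 := rfl
    have hV : coefV f lam 0 p 1 = 0 := rfl
    rw [hU, hV]
    ext a b
    fin_cases a <;> fin_cases b <;> simp [Matrix.mul_apply]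
  · ext a b
    rw [Matrix.mul_apply, Fintype.sum_prod_type, Fin.sum_univ_succ]
    fin_cases a <;> fin_cases b <;> simp [coefMat, blockE]

lemma blockQuasidet_eq (hlam : ∀ i < n, lam i ≠ 0)
    (hθ : ∀ i < n, θ i p = eigMat 1 (f i p) (φ i p) (φ' i p))
    (hnd : Nondegenerate f lam n p) (hφ : ∀ i < n, φ i p ≠ 0 ∧ φ' i p ≠ 0) :
    blockQuasidet θ lam n p = !![0, coefU f lam n p 1; coefV f lam n p 1, 0] := by
  have hu := isUnit_ThetaHat hlam hθ hnd hφ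
  have hT : Theta θ n p = -(coefMat f lam n p * ThetaHat θ lam n p) := by
    rw [coefMat_mul_ThetaHat hlam hθ hnd, neg_neg]
  rw [blockQuasidet, quasidet, hT, Matrix.neg_mul, Matrix.neg_mul, zero_sub, neg_neg,
    Matrix.mul_assoc (coefMat f lam n p), Matrix.mul_nonsing_inv _
      ((Matrix.isUnit_iff_isUnit_det _).mp hu), Matrix.mul_one, coefMat_mul_blockE]

end Matrices

/-! ### The explicit formulas for one and two steps -/

section Explicit

variable {D : Set (ℝ × ℝ)} {f : ℕ → ℝ × ℝ → ℂ} {lam : ℕ → ℂ} {p : ℝ × ℝ}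

/-- Differentiability is not required: over a field a constant factor commutes with `deriv` even at
its default value. -/
lemma dx_const_mul (a : ℂ) (g : ℝ × ℝ → ℂ) (p : ℝ × ℝ) :
    dx (fun p => a * g p) p = a * dx g p := deriv_const_mul_field _

lemma Nondegenerate.quasi_one (hlam : ∀ i < 1, lam i ≠ 0) (h : Nondegenerate f lam 1 p) :
    quasiOne f lam 1 p = -(1 / lam 0) * (1 / f 0 p) ∧
      quasiF f lam 1 p = -(1 / lam 0) * f 0 p := by
  rw [h.quasiOne_eq hlam, h.quasiF_eq hlam, coefU_succ, coefV_succ]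
  simp [coefU, coefV, coefPair, eigU_zero, eigV_zero]

lemma Nondegenerate.ne_zero_of_two (hlam : ∀ i < 2, lam i ≠ 0) (h : Nondegenerate f lam 2 p) :
    f 0 p ≠ 0 ∧ lam 1 * f 0 p - lam 0 * f 1 p ≠ 0 ∧ lam 0 * f 0 p - lam 1 * f 1 p ≠ 0 := by
  have h0 : lam 0 ≠ 0 := hlam 0 (by norm_num)
  have hf0 : f 0 p ≠ 0 := (h 0 (by norm_num)).2
  obtain ⟨hu, hv⟩ := h 1 (by norm_num)
  rw [eigU_succ] at hu
  rw [eigV_succ] at hv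
  simp only [eigU_zero, eigV_zero] at hu hv
  refine ⟨hf0, fun h1 => hv ?_, fun h1 => hu ?_⟩
  · field_simp
    linear_combination -h1
  · field_simp
    linear_combination h1

lemma Nondegenerate.quasi_two (hlam : ∀ i < 2, lam i ≠ 0) (h : Nondegenerate f lam 2 p) :
    quasiOne f lam 2 p = (lam 0 ^ 2 - lam 1 ^ 2) / (lam 0 * lam 1)
        * (1 / (lam 1 * f 0 p - lam 0 * f 1 p)) ∧
      quasiF f lam 2 p = -((lam 0 ^ 2 - lam 1 ^ 2) / (lam 0 * lam 1))
        * (f 0 p * f 1 p / (lam 0 * f 0 p - lam 1 * f 1 p)) := by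
  have h0 : lam 0 ≠ 0 := hlam 0 (by norm_num)
  have h1 : lam 1 ≠ 0 := hlam 1 (by norm_num)
  obtain ⟨hf0, hv, hu⟩ := h.ne_zero_of_two hlam
  have eu : 1 - lam 1 / lam 0 * (1 / f 0 p) * f 1 p
      = (lam 0 * f 0 p - lam 1 * f 1 p) / (lam 0 * f 0 p) := by
    field_simp
  have ev : f 1 p - lam 1 / lam 0 * (f 0 p / 1) * 1
      = -(lam 1 * f 0 p - lam 0 * f 1 p) / lam 0 := by
    field_simp; ring
  rw [h.quasiOne_eq hlam, h.quasiF_eq hlam, coefU_succ, coefV_succ, coefU_succ, coefV_succ,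
    eigU_succ, eigV_succ]
  simp only [coefU_zero_right, coefV_zero_right, eigU_zero, eigV_zero, eu, ev, zero_add]
  simp only [coefU, coefV, coefPair]
  generalize hd : lam 1 * f 0 p - lam 0 * f 1 p = d at *
  generalize he : lam 0 * f 0 p - lam 1 * f 1 p = e at *
  constructor <;> field_simp <;> rw [← hd, ← he] <;> ring

end Explicit

end

end DNLS

open DNLS in
theorem mainTheorem2 (m : WithTop ℕ∞) (hm : 2 ≤ m) (D : Set (ℝ × ℝ)) (hD : IsOpen D)
    (q r : ℝ × ℝ → ℂ) (hqr : DNLS.IsSolution m D q r)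
    (n : ℕ) (lam : ℕ → ℂ) (hlam : ∀ i < n, lam i ≠ 0)
    (f : ℕ → ℝ × ℝ → ℂ) (hf : ∀ i < n, DNLS.IsRiccatiSolution m D q r (lam i) (f i)) :
    -- the n-fold iterated Darboux transformation with matrix eigenfunctions `θ_1, …, θ_n`
    (∀ φ φ' : ℕ → ℝ × ℝ → ℂ, ∀ θ : ℕ → ℝ × ℝ → Matrix (Fin 2) (Fin 2) ℂ,
      (∀ i < n, θ i = DNLS.thetaMat (f i) (φ i) (φ' i)) →
      (∀ i < n, DNLS.IsEigenfunction m D q r (lam i) (θ i)) →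
      (∀ k < n, ∀ p ∈ D, IsUnit (DNLS.thetaIter θ lam k k p)) →
      -- the quasideterminants are defined and of class `C^m`
      (∀ p ∈ D, IsUnit (DNLS.ThetaHat θ lam n p)) ∧
      (∀ k ≤ n, ∀ p ∈ D, IsUnit (DNLS.matOne f lam k p) ∧ IsUnit (DNLS.matF f lam k p)) ∧
      (∀ a b, ContDiffOn ℝ m (fun p => DNLS.blockQuasidet θ lam n p a b) D) ∧
      -- the quasideterminant formula for `R_{[n+1]}`
      (∀ p ∈ D, DNLS.sigma ^ n * DNLS.RIter (DNLS.R q r) θ lam n p * DNLS.sigma ^ n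
        = DNLS.R q r p + DNLS.dxMat (DNLS.blockQuasidet θ lam n) p) ∧
      -- the diagonal entries of the quasideterminant vanish
      (∀ p ∈ D, ∀ a, DNLS.blockQuasidet θ lam n p a a = 0) ∧
      -- `R_{[n+1]}` is off-diagonal with entries the explicit `q_{[n+1]}`, `r_{[n+1]}`
      (∀ p ∈ D, DNLS.RIter (DNLS.R q r) θ lam n p
        = DNLS.R (DNLS.qNew q r f lam n) (DNLS.rNew q r f lam n) p) ∧
      -- and these solve the coupled DNLS system again
      DNLS.IsSolution m D (DNLS.qNew q r f lam n) (DNLS.rNew q r f lam n)) ∧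
    -- the explicit formulas in arbitrary Riccati solutions give a new solution
    ((∀ k ≤ n, ∀ p ∈ D, IsUnit (DNLS.matOne f lam k p) ∧ IsUnit (DNLS.matF f lam k p)) →
      ContDiffOn ℝ m (DNLS.quasiOne f lam n) D ∧
      ContDiffOn ℝ m (DNLS.quasiF f lam n) D ∧
      DNLS.IsSolution m D (DNLS.qNew q r f lam n) (DNLS.rNew q r f lam n) ∧
      (n = 1 → ∀ p ∈ D,
        DNLS.qNew q r f lam n p = r p - 1 / lam 0 * DNLS.dx (f 0) p ∧
        DNLS.rNew q r f lam n p = q p - 1 / lam 0 * DNLS.dx (fun p' => 1 / f 0 p') p) ∧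
      (n = 2 → ∀ p ∈ D,
        (lam 1 * f 0 p - lam 0 * f 1 p ≠ 0 ∧ lam 0 * f 0 p - lam 1 * f 1 p ≠ 0) ∧
        DNLS.qNew q r f lam n p = q p + (lam 0 ^ 2 - lam 1 ^ 2) / (lam 0 * lam 1)
          * DNLS.dx (fun p' => 1 / (lam 1 * f 0 p' - lam 0 * f 1 p')) p ∧
        DNLS.rNew q r f lam n p = r p - (lam 0 ^ 2 - lam 1 ^ 2) / (lam 0 * lam 1)
          * DNLS.dx (fun p' => f 0 p' * f 1 p' / (lam 0 * f 0 p' - lam 1 * f 1 p')) p)) := by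
  have hm0 : m ≠ 0 := by rintro rfl; simp at hm
  constructor
  · intro φ φ' θ hθ _ hunit
    have hboth := fun p (hp : p ∈ D) =>
      nondegenerate_of_thetaIter hlam hθ (fun k hk => hunit k hk p hp)
    have hnd : ∀ p ∈ D, Nondegenerate f lam n p := fun p hp => (hboth p hp).1
    have hθp : ∀ p, ∀ i < n, θ i p = eigMat 1 (f i p) (φ i p) (φ' i p) := by
      intro p i hi
      rw [hθ i hi, thetaMat, eigMat, one_mul, one_mul]
    have hquasi : ∀ p ∈ D, blockQuasidet θ lam n p
        = !![0, coefU f lam n p 1; coefV f lam n p 1, 0] := fun p hp =>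
      blockQuasidet_eq hlam (hθp p) (hnd p hp) (hboth p hp).2
    obtain ⟨hU, hV, hpot⟩ := potPair_eq hD hm hqr hlam hf le_rfl hnd
    have hR := RIter_eq (q := q) (r := r) hD hlam hθ hunit le_rfl fun k hk =>
      (potPair_succ hD hm hqr hlam hf hk fun p hp => (hnd p hp).mono hk).2.2
    refine ⟨fun p hp => isUnit_ThetaHat hlam (hθp p) (hnd p hp) (hboth p hp).2,
      fun k hk p hp => ((hnd p hp).mono hk).isUnit fun i hi => hlam i (hi.trans_le hk),
      fun a b => ?_, fun p hp => ?_, fun p hp a => ?_, fun p hp => ?_,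
      isSolution_new hD hm hqr hlam hf hnd⟩
    · refine ContDiffOn.congr (f := fun p =>
        (!![0, coefU f lam n p 1; coefV f lam n p 1, 0] : Matrix (Fin 2) (Fin 2) ℂ) a b) ?_
        fun p hp => by rw [hquasi p hp]
      fin_cases a <;> fin_cases b
      · exact contDiffOn_const
      · exact hU
      · exact hV
      · exact contDiffOn_const
    · have hconj : ∀ X, sigma ^ n * (sigma ^ n * X * sigma ^ n) * sigma ^ n = X := by
        intro X
        rw [mul_assoc (sigma ^ n) X, ← mul_assoc (sigma ^ n), sigma_pow_mul_sigma_pow, one_mul,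
          mul_assoc, sigma_pow_mul_sigma_pow, mul_one]
      rw [hR p hp, hconj, dxMat_congr hD hquasi hp, dxMat_offDiag, (hpot p hp).1, (hpot p hp).2]
      ext a b
      fin_cases a <;> fin_cases b <;> simp [R]
    · rw [hquasi p hp]
      fin_cases a <;> rfl
    · obtain ⟨h1, h2⟩ := qNew_eq hD hlam hnd hpot hp
      rw [hR p hp, sigma_pow_conj, R, h1, h2]
      split_ifs <;> rfl
  · intro hunit
    have hnd : ∀ p ∈ D, Nondegenerate f lam n p := fun p hp =>
      nondegenerate_of_isUnit hlam fun j hj => hunit j hj p hp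
    obtain ⟨hU, hV, -⟩ := potPair_eq hD hm hqr hlam hf le_rfl hnd
    refine ⟨hU.congr fun p hp => (hnd p hp).quasiOne_eq hlam,
      hV.congr fun p hp => (hnd p hp).quasiF_eq hlam, isSolution_new hD hm hqr hlam hf hnd, ?_, ?_⟩
    · rintro rfl p hp
      rw [qNew, rNew, if_pos odd_one, if_pos odd_one,
        dx_congr hD (fun p hp => ((hnd p hp).quasi_one hlam).1) hp,
        dx_congr hD (fun p hp => ((hnd p hp).quasi_one hlam).2) hp, dx_const_mul,
        dx_const_mul (g := fun p => 1 / f 0 p)]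
      exact ⟨by ring, by ring⟩
    · rintro rfl p hp
      have h2 : ¬ Odd 2 := by decide
      refine ⟨((hnd p hp).ne_zero_of_two hlam).2, ?_⟩
      rw [qNew, rNew, if_neg h2, if_neg h2,
        dx_congr hD (fun p hp => ((hnd p hp).quasi_two hlam).1) hp,
        dx_congr hD (fun p hp => ((hnd p hp).quasi_two hlam).2) hp,
        dx_const_mul (g := fun p => 1 / (lam 1 * f 0 p - lam 0 * f 1 p)),
        dx_const_mul (g := fun p => f 0 p * f 1 p / (lam 0 * f 0 p - lam 1 * f 1 p))]
      exact ⟨rfl, by ring⟩
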